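/- **Setting.** Let $\mathcal G=(\mathcal V,\mathcal E)$ be a tree with nodes $\mathcal V=\{1,\dots,N\}$, each edge being written $(j,k)$ with $j<k$. Let $\mathbb X_1,\dots,\mathbb X_N$ be compact Polish spaces, $\mathbb X=\mathbb X_1\times\dots\times\mathbb X_N$, with finite Borel reference measures $\lambda_i$ on $\mathbb X_i$ (for instance the counting measure on a finite set, or the Lebesgue measure on a compact subset of $\mathbb R^{d_i}$); products of spaces carry the product reference measures. $\mathcal M^+$ denotes finite nonnegative Borel measures. Fix $\kappa\in\mathbb R$. The entropy of $\pi\in\mathcal M^+$ relative to the reference measure $\lambda$ of its space is $$E(\pi)=\int(\log\sigma_\pi-\kappa)\,d\pi\quad\text{if }\pi=\sigma_\pi\lambda,\qquad E(\pi)=+\infty\text{ otherwise}$$ ($\kappa=0$ gives $\int\log\sigma_\pi\,d\pi$; $\kappa=1$ gives the Kullback–Leibler divergence $\mathrm{KL}(\pi,\lambda)$ up to the additive constant $\lambda$(space)). An entropy function is a convex, lower semicontinuous $\varphi:\mathbb R\to[0,\infty]$ with $\varphi(1)=0$ and $\varphi=\infty$ on $(-\infty,0)$. Put $\varphi'_\infty=\lim_{x\to\infty}\varphi(x)/x$,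 and, with the Lebesgue decomposition $\mu=\sigma_\mu\nu+\mu^\perp$, $D_\varphi(\mu,\nu)=\int\varphi\circ\sigma_\mu\,d\nu+\varphi'_\infty\,\mu^\perp(\text{space})$ (with $0\cdot\infty=0$). Let $\iota_S$ be $0$ on $S$ and $+\infty$ off $S$. For $\delta>0$, a continuous cost $c$, entropy functions $\varphi_i$ and measures $\mu_i\in\mathcal M^+(\mathbb X_i)$ let $$\mathrm{UMOT}_\delta^{(c,(\varphi_i))}((\mu_i))=\inf_{\pi\in\mathcal M^+(\mathbb X)}\int c\,d\pi+\delta E(\pi)+\sum_{i=1}^N D_{\varphi_i}(\pi_i,\mu_i),$$ where $\pi_i$ is the $i$-th marginal of $\pi$. The same problem on $\mathbb X_j\times\mathbb X_k$ is denoted $\mathrm{UOT}_\delta^{(c,\varphi_j,\varphi_k)}(\mu_j,\mu_k)$. **Data.** Let $\varepsilon>0$; let $t_e\in(0,1]$, $e\in\mathcal E$, with $\sum_{e}t_e=1$; let $c_{(j,k)}\in C(\mathbb X_j\times\mathbb X_k)$ for $(j,k)\in\mathcal E$, and $c_t=\sum_{(j,k)\in\mathcal E}t_{(j,k)}c_{(j,k)}$.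 Let $\mathcal V=V\cup U$ be a disjoint decomposition in which $V$ contains only leaves (nodes of degree $1$). For $v\in V$ let $\mu_v\in\mathcal M^+(\mathbb X_v)$ and an entropy function $\varphi_v$ be given, and let $t_v=t_e$ for the only edge $e$ at $v$. In the $\mathrm{UOT}$ problems put $\varphi_u=\iota_{\{1\}}$ for $u\in U$ (exact matching). In the $\mathrm{UMOT}$ problem put $\varphi_u=\iota_{[0,\infty)}$ for $u\in U$ (no penalty; its value then does not depend on the measures $\mu_u$, $u\in U$). **Corollary.** Then $$\inf_{(\mu_u)_{u\in U},\ \mu_u\in\mathcal M^+(\mathbb X_u)}\ \sum_{(j,k)\in\mathcal E}t_{(j,k)}\,\mathrm{UOT}_{\varepsilon/t_{(j,k)}}^{(c_{(j,k)},\varphi_j,\varphi_k)}(\mu_j,\mu_k)-\varepsilon\sum_{u\in U}(\deg(u)-1)E(\mu_u)\;=\;\mathrm{UMOT}_\varepsilon^{(c_t,(t_v\varphi_v)_{v\in V},(\varphi_u)_{u\in U})}\bigl((\mu_v)_{v\in V},(\mu_u)_{u\in U}\bigr),$$ where the expression on the left is $+\infty$ whenever its first sum is. Moreover, if this common value is not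 $+\infty$, then the $\mathrm{UMOT}$ problem on the right has exactly one optimal plan $\hat\pi$, and the left-hand side has exactly one minimizer $(\hat\mu_u)_{u\in U}$, given by the marginals $\hat\mu_u=(P_{\mathbb X_u})_\#\hat\pi$, $u\in U$. -/

import Mathlib

open MeasureTheory Set Filter
open scoped ENNReal

noncomputable section

namespace TreeUMOT

/-! ### Entropy functions and divergences -/

/-- Entropy functions: nonnegative, convex, lower semicontinuous `φ : ℝ → [0, ∞]` with `φ 1 = 0`
and `φ = ∞` on the negative half-line. -/
structure IsEntropyFunction (φ : ℝ → ℝ≥0∞) : Prop where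
  convex : ∀ x y a b : ℝ, 0 ≤ a → 0 ≤ b → a + b = 1 →
    φ (a * x + b * y) ≤ ENNReal.ofReal a * φ x + ENNReal.ofReal b * φ y
  lsc : LowerSemicontinuous φ
  one : φ 1 = 0
  neg : ∀ x < 0, φ x = ∞

/-- The convex indicator function of a set: `0` on `S` and `∞` off `S`. -/
def indicatorFn (S : Set ℝ) : ℝ → ℝ≥0∞ :=
  open Classical in fun x => if x ∈ S then 0 else ∞

/-- The function `t φ` for a weight `t`. -/
def scaleFn (t : ℝ) (φ : ℝ → ℝ≥0∞) : ℝ → ℝ≥0∞ := fun x => ENNReal.ofReal t * φ x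

/-- The recession constant `lim_{x → ∞} φ x / x` (the limit exists in `[0, ∞]` when `φ` is an
entropy function, so it equals the upper limit). -/
def recession (φ : ℝ → ℝ≥0∞) : ℝ≥0∞ :=
  limsup (fun x : ℝ => φ x / ENNReal.ofReal x) atTop

/-- The `φ`-divergence of `μ` from `ν`, through the Lebesgue decomposition `μ = σ ν + μ^⊥`. -/
def divergence {α : Type*} [MeasurableSpace α] (φ : ℝ → ℝ≥0∞) (μ ν : Measure α) : ℝ≥0∞ :=
  (∫⁻ x, φ (μ.rnDeriv ν x).toReal ∂ν) + recession φ * μ.singularPart ν univ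

/-- The entropy `∫ (log σ - κ) dπ` of `π = σ lam` relative to a finite reference measure `lam`;
it is `∞` if `π` is not absolutely continuous or the (always well-defined) integral is infinite.
For `κ = 0` it is `∫ log σ dπ`; for `κ = 1` it is `KL(π, lam) - lam(α)`. -/
def entropy {α : Type*} [MeasurableSpace α] (κ : ℝ) (lam π : Measure α) : EReal :=
  open Classical in
  if π ≪ lam ∧ Integrable (llr π lam) π then
    ((∫ x, llr π lam x ∂π - κ * π.real univ : ℝ) : EReal)
  else ⊤

/-! ### Regularized unbalanced (multi-marginal) optimal transport -/

/-- The functional minimized in the regularized unbalanced two-marginal problem. -/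
def uotObjective {α β : Type*} [MeasurableSpace α] [MeasurableSpace β]
    (κ : ℝ) (lam₁ : Measure α) (lam₂ : Measure β) (ε : ℝ) (c : α × β → ℝ) (φ₁ φ₂ : ℝ → ℝ≥0∞)
    (μ₁ : FiniteMeasure α) (μ₂ : FiniteMeasure β) (π : FiniteMeasure (α × β)) : EReal :=
  ((∫ z, c z ∂(π : Measure (α × β)) : ℝ) : EReal)
    + (ε : EReal) * entropy κ (lam₁.prod lam₂) (π : Measure (α × β))
    + ((divergence φ₁ ((π : Measure (α × β)).map Prod.fst) μ₁
        + divergence φ₂ ((π : Measure (α × β)).map Prod.snd) μ₂ : ℝ≥0∞) : EReal)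

/-- The value of the regularized unbalanced two-marginal problem. -/
def UOT {α β : Type*} [MeasurableSpace α] [MeasurableSpace β]
    (κ : ℝ) (lam₁ : Measure α) (lam₂ : Measure β) (ε : ℝ) (c : α × β → ℝ) (φ₁ φ₂ : ℝ → ℝ≥0∞)
    (μ₁ : FiniteMeasure α) (μ₂ : FiniteMeasure β) : EReal :=
  ⨅ π : FiniteMeasure (α × β), uotObjective κ lam₁ lam₂ ε c φ₁ φ₂ μ₁ μ₂ π

variable {N : ℕ} {X : Fin N → Type*} [∀ i, MeasurableSpace (X i)]

/-- The functional minimized in the regularized unbalanced multi-marginal problem. -/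
def umotObjective (κ : ℝ) (lam : ∀ i, Measure (X i)) (ε : ℝ) (c : (∀ i, X i) → ℝ)
    (φ : Fin N → ℝ → ℝ≥0∞) (μ : ∀ i, FiniteMeasure (X i)) (π : FiniteMeasure (∀ i, X i)) : EReal :=
  ((∫ x, c x ∂(π : Measure (∀ i, X i)) : ℝ) : EReal)
    + (ε : EReal) * entropy κ (Measure.pi lam) (π : Measure (∀ i, X i))
    + ((∑ i, divergence (φ i) ((π : Measure (∀ i, X i)).map (fun x => x i)) (μ i) : ℝ≥0∞) : EReal)

/-- The value of the regularized unbalanced multi-marginal problem. -/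
def UMOT (κ : ℝ) (lam : ∀ i, Measure (X i)) (ε : ℝ) (c : (∀ i, X i) → ℝ)
    (φ : Fin N → ℝ → ℝ≥0∞) (μ : ∀ i, FiniteMeasure (X i)) : EReal :=
  ⨅ π : FiniteMeasure (∀ i, X i), umotObjective κ lam ε c φ μ π

/-! ### Tree-structured problems -/

/-- The edges of `G`, each one listed once, as a pair `(j, k)` with `j < k`. -/
def orderedEdges (G : SimpleGraph (Fin N)) [DecidableRel G.Adj] : Finset (Fin N × Fin N) :=
  Finset.univ.filter fun e => e.1 < e.2 ∧ G.Adj e.1 e.2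

/-- The cost `∑_{(j,k)} t_{(j,k)} c_{(j,k)}(x_j, x_k)`. -/
def treeCost (G : SimpleGraph (Fin N)) [DecidableRel G.Adj] (t : Sym2 (Fin N) → ℝ)
    (c : ∀ j k, X j × X k → ℝ) (x : ∀ i, X i) : ℝ :=
  ∑ e ∈ orderedEdges G, t s(e.1, e.2) * c e.1 e.2 (x e.1, x e.2)

/-- The weight `t_v` of a leaf `v`: the weight of the edge at `v` (the sum has exactly one term
when `v` is a leaf). -/
def leafWeight (G : SimpleGraph (Fin N)) [DecidableRel G.Adj] (t : Sym2 (Fin N) → ℝ)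
    (v : Fin N) : ℝ :=
  ∑ e ∈ G.incidenceFinset v, t e

/-- A family of measures on all nodes, from one on `V` and one on the complement of `V`. -/
def joinMeasures (V : Finset (Fin N)) (μ : ∀ v : {i // i ∈ V}, FiniteMeasure (X v))
    (ν : ∀ u : {i // i ∉ V}, FiniteMeasure (X u)) (i : Fin N) : FiniteMeasure (X i) :=
  if h : i ∈ V then μ ⟨i, h⟩ else ν ⟨i, h⟩

/-- The entropy functions of the pairwise problems: `φ_v` on `V`, and `ι_{{1}}` (exact matching)
off `V`. -/
def exactOff (V : Finset (Fin N)) (φ : {i // i ∈ V} → ℝ → ℝ≥0∞) (i : Fin N) : ℝ → ℝ≥0∞ :=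
  if h : i ∈ V then φ ⟨i, h⟩ else indicatorFn {1}

/-- The entropy functions of the multi-marginal problem: `t_v φ_v` on `V`, and `ι_{[0,∞)}` (no
penalty) off `V`. -/
def freeOff (G : SimpleGraph (Fin N)) [DecidableRel G.Adj] (t : Sym2 (Fin N) → ℝ)
    (V : Finset (Fin N)) (φ : {i // i ∈ V} → ℝ → ℝ≥0∞) (i : Fin N) : ℝ → ℝ≥0∞ :=
  if h : i ∈ V then scaleFn (leafWeight G t i) (φ ⟨i, h⟩) else indicatorFn (Ici 0)

/-- The sum `∑_{(j,k)} t_{(j,k)} UOT_{ε/t_{(j,k)}}(μ_j, μ_k)` over the edges. -/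
def edgeSum (G : SimpleGraph (Fin N)) [DecidableRel G.Adj] (κ : ℝ) (lam : ∀ i, Measure (X i))
    (ε : ℝ) (t : Sym2 (Fin N) → ℝ) (c : ∀ j k, X j × X k → ℝ) (φ : Fin N → ℝ → ℝ≥0∞)
    (μ : ∀ i, FiniteMeasure (X i)) : EReal :=
  ∑ e ∈ orderedEdges G, (t s(e.1, e.2) : EReal) *
    UOT κ (lam e.1) (lam e.2) (ε / t s(e.1, e.2)) (c e.1 e.2) (φ e.1) (φ e.2) (μ e.1) (μ e.2)

/-- The functional `∑_e t_e UOT_{ε/t_e}(μ_j, μ_k) - ε ∑_u (deg u - 1) E(μ_u)` of the measures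
`ν = (μ_u)` off `V`. It is `∞` wherever the first sum is, also where the subtracted term is
infinite too. -/
def innerObjective (G : SimpleGraph (Fin N)) [DecidableRel G.Adj] (κ : ℝ)
    (lam : ∀ i, Measure (X i)) (ε : ℝ) (t : Sym2 (Fin N) → ℝ) (c : ∀ j k, X j × X k → ℝ)
    (V : Finset (Fin N)) (φ : {i // i ∈ V} → ℝ → ℝ≥0∞)
    (μ : ∀ v : {i // i ∈ V}, FiniteMeasure (X v))
    (ν : ∀ u : {i // i ∉ V}, FiniteMeasure (X u)) : EReal :=
  open Classical in
  if edgeSum G κ lam ε t c (exactOff V φ) (joinMeasures V μ ν) = ⊤ then ⊤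
  else edgeSum G κ lam ε t c (exactOff V φ) (joinMeasures V μ ν)
    - (ε : EReal) * ∑ u : {i // i ∉ V}, (((G.degree u : ℝ) - 1 : ℝ) : EReal) *
        entropy κ (lam u) (ν u : Measure (X u))

end TreeUMOT

end

/-! On a tree, a plan `π` on the product with node marginals `P i` and edge marginals `Pe i j` sees
the cost only through the edge marginals and the penalties only through the node marginals. Only its
entropy depends on more. Among the plans with given edge marginals, the entropy is smallest for the
Markov plan, whose density is the product of the node densities times, for each edge, the edge
density divided by its two node densities. Its logarithm is a sum of functions of one or two
neighbouring coordinates, so its integral against `π` depends on the marginals alone; Gibbs'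
inequality then gives E(π) ≥ ∑_e E(π_e) - ∑_i (deg i - 1) E(π_i), with equality for the Markov plan
(`treeEntropy`, `HasFiniteEntropies.treeEntropy_le`, `HasFiniteEntropies.exists_glued_entropy_eq`).

The right-hand side is what the weighted edge problems produce. Since t_e (ε / t_e) = ε, every edge
entropy has weight ε; a node of `V` lies on one edge, so its penalty gets the weight t_v and its
degree correction vanishes (`sum_edgeValue_sub`).

Two comparisons follow. The marginals of any plan compete in the edge problems, so they do at least
as well as the plan (`innerObjective_le_of_marginals`). Conversely, for inner measures of finite
value, the edge problems have optimal plans; exact matching makes these agree at the inner nodes,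
and gluing them yields a plan with the same value and these marginals
(`exists_multi_of_innerObjective_ne_top`). Hence the values agree and minimizers correspond.

Existence and uniqueness, for the edge problems and for the whole, come from one theorem
(`existsUnique_regularizedObjective`): the entropy is so convex that minimizing sequences of
densities are Cauchy in L¹, and the functional is lower semicontinuous there. -/

noncomputable section

namespace TreeUMOT

open scoped Topology

/-! ### Convexity and L¹ lower semicontinuity of divergence penalties -/

section Divergence

variable {α β : Type*} [MeasurableSpace α] [MeasurableSpace β]

lemma IsEntropyFunction.measurable {φ : ℝ → ℝ≥0∞} (hφ : IsEntropyFunction φ) : Measurable φ :=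
  hφ.lsc.measurable

lemma rnDeriv_mono_left {τ τ' μ : Measure α} [IsFiniteMeasure τ] [IsFiniteMeasure τ']
    [IsFiniteMeasure μ] (h : τ ≤ τ') : τ.rnDeriv μ ≤ᵐ[μ] τ'.rnDeriv μ := by
  have h' : τ' = (τ' - τ) + τ := (Measure.sub_add_cancel_of_le h).symm
  rw [h']
  filter_upwards [Measure.rnDeriv_add (τ' - τ) τ μ] with x hx
  rw [hx]
  exact le_add_self

lemma singularPart_univ_mono_left {τ τ' μ : Measure α} [IsFiniteMeasure τ] [IsFiniteMeasure τ']
    [IsFiniteMeasure μ] (h : τ ≤ τ') : τ.singularPart μ univ ≤ τ'.singularPart μ univ := by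
  have h' : τ' = (τ' - τ) + τ := (Measure.sub_add_cancel_of_le h).symm
  rw [h', Measure.singularPart_add]
  exact le_add_self

/-- The divergence from `μ` is midpoint convex. -/
lemma divergence_midpoint_le {φ : ℝ → ℝ≥0∞} (hφ : IsEntropyFunction φ) (τ₁ τ₂ μ : Measure α)
    [IsFiniteMeasure τ₁] [IsFiniteMeasure τ₂] [IsFiniteMeasure μ] :
    divergence φ ((2⁻¹ : NNReal) • (τ₁ + τ₂)) μ
      ≤ 2⁻¹ * (divergence φ τ₁ μ + divergence φ τ₂ μ) := by
  have hs : (2⁻¹ : ℝ≥0∞) = ((2⁻¹ : NNReal) : ℝ≥0∞) := by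
    rw [ENNReal.coe_inv (by norm_num)]; norm_num
  have h1 : ∫⁻ x, φ (((2⁻¹ : NNReal) • (τ₁ + τ₂)).rnDeriv μ x).toReal ∂μ
      ≤ 2⁻¹ * (∫⁻ x, φ (τ₁.rnDeriv μ x).toReal ∂μ + ∫⁻ x, φ (τ₂.rnDeriv μ x).toReal ∂μ) := by
    have hm : ∀ τ : Measure α, Measurable fun x => φ (τ.rnDeriv μ x).toReal := fun τ =>
      hφ.measurable.comp (Measure.measurable_rnDeriv _ _).ennreal_toReal
    rw [← lintegral_add_left (hm τ₁), ← lintegral_const_mul]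
    · apply lintegral_mono_ae
      filter_upwards [Measure.rnDeriv_smul_left (τ₁ + τ₂) μ (2⁻¹ : NNReal),
        Measure.rnDeriv_add τ₁ τ₂ μ, Measure.rnDeriv_ne_top τ₁ μ, Measure.rnDeriv_ne_top τ₂ μ]
        with x hx1 hx2 h1 h2
      rw [hx1, Pi.smul_apply, hx2, Pi.add_apply]
      have := hφ.convex (τ₁.rnDeriv μ x).toReal (τ₂.rnDeriv μ x).toReal 2⁻¹ 2⁻¹ (by norm_num)
        (by norm_num) (by norm_num)
      have e : ((2⁻¹ : NNReal) • (τ₁.rnDeriv μ x + τ₂.rnDeriv μ x)).toReal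
          = 2⁻¹ * (τ₁.rnDeriv μ x).toReal + 2⁻¹ * (τ₂.rnDeriv μ x).toReal := by
        rw [ENNReal.smul_def, smul_eq_mul, ENNReal.toReal_mul, ENNReal.toReal_add h1 h2]
        simp
        ring
      rw [e, mul_add]
      refine this.trans (le_of_eq ?_)
      have : ENNReal.ofReal 2⁻¹ = 2⁻¹ := by
        rw [ENNReal.ofReal_inv_of_pos (by norm_num)]; norm_num
      rw [this]
    · exact (hm τ₁).add (hm τ₂)
  unfold divergence
  rw [Measure.singularPart_smul, Measure.singularPart_add]
  calc _ ≤ 2⁻¹ * (∫⁻ x, φ (τ₁.rnDeriv μ x).toReal ∂μ + ∫⁻ x, φ (τ₂.rnDeriv μ x).toReal ∂μ)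
        + recession φ * ((2⁻¹ : NNReal) • (τ₁.singularPart μ + τ₂.singularPart μ)) univ := by
        gcongr
    _ = _ := by
        rw [Measure.smul_apply, Measure.add_apply, ENNReal.smul_def, smul_eq_mul, ← hs]
        ring

/-- The singular part of the divergence is lower semicontinuous. -/
lemma recession_mul_singularPart_le {r b : ℝ≥0∞} {τ : Measure α} {τs ηs : ℕ → Measure α}
    {μ : Measure α} [IsFiniteMeasure τ] [∀ n, IsFiniteMeasure (τs n)]
    [∀ n, IsFiniteMeasure (ηs n)] [IsFiniteMeasure μ]
    (h2 : ∀ n, τ ≤ τs n + ηs n) (hη : Tendsto (fun n => ηs n univ) atTop (𝓝 0))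
    (hb : ∀ n, r * (τs n).singularPart μ univ ≤ b) : r * τ.singularPart μ univ ≤ b := by
  -- The constant `r` may be `∞`, and multiplication by `∞` is continuous only away from `0`.
  by_cases hs : τ.singularPart μ univ = 0
  · simp [hs]
  have ht : Tendsto (fun n => r * (τ.singularPart μ univ - ηs n univ)) atTop
      (𝓝 (r * τ.singularPart μ univ)) := by
    apply ENNReal.Tendsto.const_mul
    · have := ENNReal.Tendsto.sub (tendsto_const_nhds (x := τ.singularPart μ univ)) hη
        (Or.inr (by simp))
      simpa using this
    · exact Or.inl hs
  refine le_of_tendsto ht (Eventually.of_forall fun n => le_trans ?_ (hb n))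
  gcongr
  rw [tsub_le_iff_right]
  refine (singularPart_univ_mono_left (h2 n)).trans ?_
  rw [Measure.singularPart_add, Measure.add_apply]
  gcongr
  exact Measure.singularPart_le _ _

/-- The absolutely continuous part of the divergence is lower semicontinuous. -/
lemma lintegral_rnDeriv_le {φ : ℝ → ℝ≥0∞} (hφ : IsEntropyFunction φ) {b : ℝ≥0∞} {τ : Measure α}
    {τs ηs : ℕ → Measure α}
    {μ : Measure α} [IsFiniteMeasure τ] [∀ n, IsFiniteMeasure (τs n)]
    [∀ n, IsFiniteMeasure (ηs n)] [IsFiniteMeasure μ]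
    (h1 : ∀ n, τs n ≤ τ + ηs n)
    (h2 : ∀ n, τ ≤ τs n + ηs n) (hη : Tendsto (fun n => ηs n univ) atTop (𝓝 0))
    (hb : ∀ n, ∫⁻ x, φ ((τs n).rnDeriv μ x).toReal ∂μ ≤ b) :
    ∫⁻ x, φ (τ.rnDeriv μ x).toReal ∂μ ≤ b := by
  -- The masses of `ηs n` tend to 0, so their densities tend to 0 a.e. along a subsequence. The
  -- two-sided domination then squeezes the densities of `τs` to that of `τ`, and Fatou's lemma
  -- applies.
  have hm : TendstoInMeasure μ (fun n x => ((ηs n).rnDeriv μ x).toReal) atTop (fun _ => (0 : ℝ)) := by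
    refine tendstoInMeasure_of_tendsto_eLpNorm (p := 1) one_ne_zero
      (fun n => (Measure.measurable_rnDeriv _ _).ennreal_toReal.aestronglyMeasurable)
      aestronglyMeasurable_const ?_
    refine tendsto_of_tendsto_of_tendsto_of_le_of_le tendsto_const_nhds hη
      (fun _ => zero_le) fun n => ?_
    simp only [eLpNorm_one_eq_lintegral_enorm, Pi.sub_apply, sub_zero]
    calc _ ≤ ∫⁻ x, (ηs n).rnDeriv μ x ∂μ := by
          refine lintegral_mono fun x => ?_
          rw [Real.enorm_of_nonneg ENNReal.toReal_nonneg]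
          exact ENNReal.ofReal_toReal_le
      _ ≤ _ := Measure.lintegral_rnDeriv_le
  obtain ⟨ns, hns, hae⟩ := hm.exists_seq_tendsto_ae
  have hle1 : ∀ n, (τs n).rnDeriv μ ≤ᵐ[μ] τ.rnDeriv μ + (ηs n).rnDeriv μ := fun n =>
    (rnDeriv_mono_left (h1 n)).trans (Measure.rnDeriv_add _ _ _).le
  have hle2 : ∀ n, τ.rnDeriv μ ≤ᵐ[μ] (τs n).rnDeriv μ + (ηs n).rnDeriv μ := fun n =>
    (rnDeriv_mono_left (h2 n)).trans (Measure.rnDeriv_add _ _ _).le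
  have hlim : ∀ᵐ x ∂μ, Tendsto (fun i => ((τs (ns i)).rnDeriv μ x).toReal) atTop
      (𝓝 (τ.rnDeriv μ x).toReal) := by
    filter_upwards [hae, ae_all_iff.2 hle1, ae_all_iff.2 hle2, Measure.rnDeriv_ne_top τ μ,
      ae_all_iff.2 fun n => Measure.rnDeriv_ne_top (τs n) μ,
      ae_all_iff.2 fun n => Measure.rnDeriv_ne_top (ηs n) μ] with x hx a1 a2 t0 t1 t2
    rw [tendsto_iff_dist_tendsto_zero]
    refine squeeze_zero (fun _ => dist_nonneg) (fun i => ?_) hx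
    rw [Real.dist_eq, abs_le]
    have b1 := ENNReal.toReal_mono (ENNReal.add_ne_top.2 ⟨t0, t2 (ns i)⟩) (a1 (ns i))
    have b2 := ENNReal.toReal_mono (ENNReal.add_ne_top.2 ⟨t1 (ns i), t2 (ns i)⟩) (a2 (ns i))
    rw [ENNReal.toReal_add t0 (t2 _)] at b1
    rw [ENNReal.toReal_add (t1 _) (t2 _)] at b2
    constructor <;> linarith
  calc ∫⁻ x, φ (τ.rnDeriv μ x).toReal ∂μ
      ≤ ∫⁻ x, liminf (fun i => φ ((τs (ns i)).rnDeriv μ x).toReal) atTop ∂μ := by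
        refine lintegral_mono_ae ?_
        filter_upwards [hlim] with x hx
        exact (lowerSemicontinuousAt_iff_le_liminf.1 (hφ.lsc _)).trans (liminf_le_liminf_of_le hx)
    _ ≤ liminf (fun i => ∫⁻ x, φ ((τs (ns i)).rnDeriv μ x).toReal ∂μ) atTop :=
        lintegral_liminf_le fun i =>
          hφ.measurable.comp (Measure.measurable_rnDeriv _ _).ennreal_toReal
    _ ≤ b := liminf_le_of_le (by isBoundedDefault) fun c hc => by
        obtain ⟨i, hi⟩ := hc.exists
        exact hi.trans (hb _)

/-- The measure with density the positive part of an integrable function. -/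
def densityMeasure (lam : Measure α) (σ : Lp ℝ 1 lam) : Measure α :=
  lam.withDensity fun x => ENNReal.ofReal (σ x)

/-- The property of a penalty on plans under which regularized problems have unique solutions:
finiteness aside, it is midpoint convex, and lower semicontinuous in the `L¹` norm of densities. -/
structure IsConvexPenalty (lam : Measure α) (D : Measure α → ℝ≥0∞) : Prop where
  midpoint : ∀ π₁ π₂ : Measure α, IsFiniteMeasure π₁ → IsFiniteMeasure π₂ →
    D ((2⁻¹ : NNReal) • (π₁ + π₂)) ≤ 2⁻¹ * (D π₁ + D π₂)
  lsc : LowerSemicontinuous fun σ : Lp ℝ 1 lam => D (densityMeasure lam σ)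

lemma IsConvexPenalty.zero {lam : Measure α} : IsConvexPenalty lam fun _ => 0 where
  midpoint := by simp
  lsc := lowerSemicontinuous_const

lemma IsConvexPenalty.add {lam : Measure α} {D D' : Measure α → ℝ≥0∞}
    (h : IsConvexPenalty lam D) (h' : IsConvexPenalty lam D') :
    IsConvexPenalty lam fun π => D π + D' π where
  midpoint π₁ π₂ i₁ i₂ := by
    calc _ ≤ 2⁻¹ * (D π₁ + D π₂) + 2⁻¹ * (D' π₁ + D' π₂) :=
          add_le_add (h.midpoint _ _ i₁ i₂) (h'.midpoint _ _ i₁ i₂)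
      _ = _ := by ring
  lsc := h.lsc.add h'.lsc

lemma IsConvexPenalty.sum {lam : Measure α} {ι : Type*} (s : Finset ι)
    {D : ι → Measure α → ℝ≥0∞} (h : ∀ i, IsConvexPenalty lam (D i)) :
    IsConvexPenalty lam fun π => ∑ i ∈ s, D i π := by
  classical
  induction s using Finset.induction_on with
  | empty => simpa using IsConvexPenalty.zero
  | insert a s ha ih => simpa only [Finset.sum_insert ha] using (h a).add ih

instance (lam : Measure α) (σ : Lp ℝ 1 lam) : IsFiniteMeasure (densityMeasure lam σ) :=
  isFiniteMeasure_withDensity_ofReal (L1.integrable_coeFn σ).2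

lemma withDensity_enorm_sub_univ {lam : Measure α} (σ τ : Lp ℝ 1 lam) :
    (lam.withDensity fun x => ‖σ x - τ x‖ₑ) univ = edist σ τ := by
  rw [withDensity_apply _ MeasurableSet.univ, Measure.restrict_univ, Lp.edist_def,
    eLpNorm_one_eq_lintegral_enorm]
  rfl

/-- The positive part is 1-Lipschitz. Used in both directions, this turns L¹ convergence of
densities into the two-sided domination of measures that lower semicontinuity needs. -/
lemma densityMeasure_le_add {lam : Measure α} (σ τ : Lp ℝ 1 lam) :
    densityMeasure lam σ ≤ densityMeasure lam τ + lam.withDensity fun x => ‖σ x - τ x‖ₑ := by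
  unfold densityMeasure
  rw [← withDensity_add_left (Lp.stronglyMeasurable τ).measurable.ennreal_ofReal]
  refine withDensity_mono (Eventually.of_forall fun x => ?_)
  simp only [Pi.add_apply]
  rw [Real.enorm_eq_ofReal_abs]
  calc _ ≤ ENNReal.ofReal (τ x + |σ x - τ x|) :=
        ENNReal.ofReal_le_ofReal (by linarith [le_abs_self (σ x - τ x)])
    _ ≤ _ := ENNReal.ofReal_add_le

/-- The divergence of a marginal from a fixed measure is a convex penalty. -/
lemma isConvexPenalty_divergence_map {lam : Measure α} {φ : ℝ → ℝ≥0∞} (hφ : IsEntropyFunction φ)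
    {f : α → β} (hf : Measurable f) (μ : Measure β) [IsFiniteMeasure μ] :
    IsConvexPenalty lam fun π => divergence φ (π.map f) μ where
  midpoint π₁ π₂ i₁ i₂ := by
    rw [Measure.map_smul, Measure.map_add _ _ hf]
    exact divergence_midpoint_le hφ _ _ _
  lsc := by
    -- The error measure is the image of |σ_n - σ| `lam`; its mass is the L¹ distance.
    have key : ∀ (σs : ℕ → Lp ℝ 1 lam) (σ : Lp ℝ 1 lam), Tendsto σs atTop (𝓝 σ) →
        ∃ ηs : ℕ → Measure β, (∀ n, IsFiniteMeasure (ηs n)) ∧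
          (∀ n, (densityMeasure lam (σs n)).map f ≤ (densityMeasure lam σ).map f + ηs n) ∧
          (∀ n, (densityMeasure lam σ).map f ≤ (densityMeasure lam (σs n)).map f + ηs n) ∧
          Tendsto (fun n => ηs n univ) atTop (𝓝 0) := by
      intro σs σ h
      have hu : ∀ n, ((lam.withDensity fun x => ‖σs n x - σ x‖ₑ).map f) univ
          = edist (σs n) σ := fun n => by
        rw [Measure.map_apply hf MeasurableSet.univ, preimage_univ, withDensity_enorm_sub_univ]
      refine ⟨fun n => (lam.withDensity fun x => ‖σs n x - σ x‖ₑ).map f, fun n => ⟨?_⟩,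
        fun n => ?_, fun n => ?_, ?_⟩
      · rw [hu]; exact edist_lt_top _ _
      · rw [← Measure.map_add _ _ hf]
        exact Measure.map_mono (densityMeasure_le_add _ _) hf
      · rw [← Measure.map_add _ _ hf]
        refine Measure.map_mono ((densityMeasure_le_add σ (σs n)).trans (le_of_eq ?_)) hf
        congr 2
        ext x
        rw [← enorm_neg, neg_sub]
      · simp_rw [hu]
        exact tendsto_iff_edist_tendsto_0.1 h
    unfold divergence
    refine LowerSemicontinuous.add ?_ ?_
    · rw [lowerSemicontinuous_iff_isClosed_preimage]
      refine fun b => IsSeqClosed.isClosed fun σs σ hb h => ?_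
      obtain ⟨ηs, _, h1, h2, h3⟩ := key σs σ h
      exact lintegral_rnDeriv_le hφ h1 h2 h3 hb
    · rw [lowerSemicontinuous_iff_isClosed_preimage]
      refine fun b => IsSeqClosed.isClosed fun σs σ hb h => ?_
      obtain ⟨ηs, _, h1, h2, h3⟩ := key σs σ h
      exact recession_mul_singularPart_le h2 h3 hb

end Divergence

/-! ### Scalar inequalities for s log s -/

section PointwiseInequalities

/-- Young's inequality for `s log s` and the exponential function. -/
lemma mul_le_mul_log_sub_add_exp {s : ℝ} (hs : 0 ≤ s) (a : ℝ) :
    s * a ≤ s * Real.log s - s + Real.exp a := by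
  rcases hs.eq_or_lt with rfl | hs
  · simp [Real.exp_nonneg]
  have h := Real.add_one_le_exp (a - Real.log s)
  have e : Real.exp a = s * Real.exp (a - Real.log s) := by
    rw [Real.exp_sub, Real.exp_log hs]; field_simp
  rw [e]
  nlinarith

/-- Apply log x ≥ 1 - 1/x to x = √(s/m) and multiply by 2s: s log(s/m) ≥ 2s - 2√(sm), which is s - m
+ (√s - √m)². This Hellinger gap is the source of uniform convexity. -/
lemma sq_sqrt_sub_sqrt_le {s m : ℝ} (hs : 0 ≤ s) (hm : 0 < m) :
    s - m + (√s - √m) ^ 2 ≤ s * Real.log s - s * Real.log m := by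
  rcases hs.eq_or_lt with rfl | hs
  · simp [Real.sq_sqrt hm.le]
  have ha := Real.sqrt_pos.2 hs
  have hb := Real.sqrt_pos.2 hm
  have es := Real.sq_sqrt hs.le
  have em := Real.sq_sqrt hm.le
  have h := Real.one_sub_inv_le_log_of_pos (div_pos ha hb)
  rw [inv_div, Real.log_div ha.ne' hb.ne', Real.log_sqrt hs.le, Real.log_sqrt hm.le] at h
  have h2 := mul_le_mul_of_nonneg_left h (sq_nonneg (√s))
  have h3 : √s ^ 2 * (1 - √m / √s) = √s ^ 2 - √s * √m := by
    field_simp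
  rw [h3, es] at h2
  nlinarith

/-- A quantitative form of the midpoint convexity of `s log s`. -/
lemma mul_log_midpoint_add_le {s t η : ℝ} (hs : 0 ≤ s) (ht : 0 ≤ t) :
    2⁻¹ * (s + t) * Real.log (2⁻¹ * (s + t)) + 2⁻¹ * (η * |s - t| - η ^ 2 * (s + t))
      ≤ 2⁻¹ * (s * Real.log s + t * Real.log t) := by
  rcases (add_nonneg hs ht).eq_or_lt with h0 | h0
  · have : s = 0 := by linarith
    have h' : t = 0 := by linarith
    simp [this, h']
  have hm : 0 < 2⁻¹ * (s + t) := by positivity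
  have h1 := sq_sqrt_sub_sqrt_le hs hm
  have h2 := sq_sqrt_sub_sqrt_le ht hm
  set m := 2⁻¹ * (s + t) with hmdef
  have es := Real.sq_sqrt hs
  have et := Real.sq_sqrt ht
  -- Factoring |s - t| and splitting the product with parameter η trades the Hellinger gap for a
  -- term linear in |s - t|, at the price of η² (s + t).
  have h3 : |s - t| = |√s - √t| * (√s + √t) := by
    have : s - t = (√s - √t) * (√s + √t) := by linear_combination et - es
    rw [this, abs_mul, abs_of_nonneg (add_nonneg (Real.sqrt_nonneg s) (Real.sqrt_nonneg t))]
  have h4 : 2 * (η * |s - t|) ≤ (√s - √t) ^ 2 + η ^ 2 * (√s + √t) ^ 2 := by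
    rw [h3, ← sq_abs (√s - √t)]
    nlinarith [sq_nonneg (|√s - √t| - η * (√s + √t))]
  have h5 : (√s + √t) ^ 2 ≤ 2 * (s + t) := by nlinarith [sq_nonneg (√s - √t)]
  have h6 : η ^ 2 * (√s + √t) ^ 2 ≤ η ^ 2 * (2 * (s + t)) :=
    mul_le_mul_of_nonneg_left h5 (sq_nonneg _)
  have h7 : (√s - √t) ^ 2 ≤ 2 * ((√s - √m) ^ 2 + (√t - √m) ^ 2) := by
    nlinarith [sq_nonneg (√s + √t - 2 * √m)]
  have h8 : m * Real.log m = 2⁻¹ * (s * Real.log m + t * Real.log m) := by rw [hmdef]; ring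
  rw [h8]
  have : s + t = 2 * m := by rw [hmdef]; ring
  linarith

end PointwiseInequalities

/-! ### The shifted functional on L¹ and its uniform convexity -/

section Existence

variable {α : Type*} [MeasurableSpace α]

/-- A constant that makes the integrand of the shifted functional nonnegative. -/
def shiftConst (κ ε M : ℝ) : ℝ := ε * Real.exp ((M + 1) / ε + κ)

/-- The pointwise integrand `c s + ε s (log s - κ)`, shifted to be nonnegative. -/
def shiftedIntegrand (κ ε M c s : ℝ) : ℝ :=
  c * s + ε * (s * Real.log s) - ε * κ * s + shiftConst κ ε M

/-- Young's inequality with exponent (M + 1)/ε + κ, which is where `shiftConst` comes from: M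
absorbs the cost, κ the linear entropy term, and the extra 1 leaves a spare s. The functional
therefore controls the mass, not only the sign. -/
lemma le_shiftedIntegrand {κ ε M c s : ℝ} (hε : 0 < ε) (hc : |c| ≤ M) (hs : 0 ≤ s) :
    s ≤ shiftedIntegrand κ ε M c s := by
  have h := mul_le_mul_log_sub_add_exp hs ((M + 1) / ε + κ)
  have h1 := mul_le_mul_of_nonneg_left h hε.le
  have h2 : ε * (s * ((M + 1) / ε + κ)) = s * (M + 1) + ε * κ * s := by field_simp
  have h3 : -(M * s) ≤ c * s := by nlinarith [(abs_le.1 hc).1]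
  rw [h2] at h1
  unfold shiftedIntegrand shiftConst
  nlinarith [mul_nonneg hε.le hs]

lemma shiftedIntegrand_midpoint {κ ε M c s t η : ℝ} (hε : 0 < ε) (hs : 0 ≤ s) (ht : 0 ≤ t) :
    shiftedIntegrand κ ε M c (2⁻¹ * (s + t)) + ε * η / 2 * |s - t|
      ≤ 2⁻¹ * (shiftedIntegrand κ ε M c s + shiftedIntegrand κ ε M c t)
        + ε * η ^ 2 / 2 * (s + t) := by
  have h := mul_le_mul_of_nonneg_left (mul_log_midpoint_add_le (η := η) hs ht) hε.le
  unfold shiftedIntegrand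
  nlinarith

/-- The shifted functional on `L¹`. -/
def shiftedFunctional (κ : ℝ) (lam : Measure α) (ε M : ℝ) (c : α → ℝ) (D : Measure α → ℝ≥0∞)
    (σ : Lp ℝ 1 lam) : ℝ≥0∞ :=
  (∫⁻ x, ENNReal.ofReal (shiftedIntegrand κ ε M (c x) (σ x)) ∂lam) + D (densityMeasure lam σ)

variable {κ ε M : ℝ} {lam : Measure α} {c : α → ℝ} {D : Measure α → ℝ≥0∞}

lemma measurable_shiftedIntegrand (hc : Measurable c) {s : α → ℝ} (hs : Measurable s) :
    Measurable fun x => shiftedIntegrand κ ε M (c x) (s x) := by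
  unfold shiftedIntegrand
  have := Real.continuous_mul_log.measurable.comp hs
  simp only [Function.comp_def] at this
  fun_prop

/-- Fatou's lemma along an a.e. convergent subsequence; `ENNReal.ofReal` makes the integrand
nonnegative even where σ is negative, so this works on all of L¹. -/
lemma lowerSemicontinuous_shiftedFunctional (hc : Measurable c) (hD : IsConvexPenalty lam D) :
    LowerSemicontinuous (shiftedFunctional κ lam ε M c D) := by
  refine LowerSemicontinuous.add ?_ hD.lsc
  rw [lowerSemicontinuous_iff_isClosed_preimage]
  refine fun b => IsSeqClosed.isClosed fun σs σ hb h => ?_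
  obtain ⟨ns, -, hae⟩ := (tendstoInMeasure_of_tendsto_Lp h).exists_seq_tendsto_ae
  have hcont : ∀ c : ℝ, Continuous fun s => ENNReal.ofReal (shiftedIntegrand κ ε M c s) := by
    intro c
    unfold shiftedIntegrand
    have := Real.continuous_mul_log
    exact ENNReal.continuous_ofReal.comp (by fun_prop)
  calc ∫⁻ x, ENNReal.ofReal (shiftedIntegrand κ ε M (c x) (σ x)) ∂lam
      ≤ ∫⁻ x, liminf (fun i => ENNReal.ofReal
          (shiftedIntegrand κ ε M (c x) (σs (ns i) x))) atTop ∂lam := by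
        refine lintegral_mono_ae ?_
        filter_upwards [hae] with x hx
        exact (((hcont (c x)).tendsto _).comp hx).liminf_eq.ge
    _ ≤ liminf (fun i => ∫⁻ x, ENNReal.ofReal
          (shiftedIntegrand κ ε M (c x) (σs (ns i) x)) ∂lam) atTop :=
        lintegral_liminf_le fun i => (measurable_shiftedIntegrand hc
          (Lp.stronglyMeasurable _).measurable).ennreal_ofReal
    _ ≤ b := liminf_le_of_le (by isBoundedDefault) fun a ha => by
        obtain ⟨i, hi⟩ := ha.exists
        exact hi.trans (hb _)

lemma densityMeasure_midpoint {σ τ : Lp ℝ 1 lam} (hσ : 0 ≤ σ) (hτ : 0 ≤ τ) :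
    densityMeasure lam ((2⁻¹ : ℝ) • (σ + τ))
      = (2⁻¹ : NNReal) • (densityMeasure lam σ + densityMeasure lam τ) := by
  unfold densityMeasure
  rw [← withDensity_add_left (Lp.stronglyMeasurable σ).measurable.ennreal_ofReal, ENNReal.smul_def,
    ← withDensity_smul]
  · refine withDensity_congr_ae ?_
    filter_upwards [Lp.coeFn_smul (2⁻¹ : ℝ) (σ + τ), Lp.coeFn_add σ τ, (Lp.coeFn_nonneg σ).2 hσ,
      (Lp.coeFn_nonneg τ).2 hτ] with x h1 h2 h3 h4
    simp only [Pi.zero_apply] at h3 h4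
    simp only [h1, Pi.smul_apply, h2, Pi.add_apply, smul_eq_mul]
    rw [ENNReal.ofReal_mul (by norm_num), ENNReal.ofReal_add h3 h4]
    congr 1
    rw [ENNReal.ofReal_inv_of_pos (by norm_num), ENNReal.coe_inv (by norm_num)]; norm_num
  · exact (Lp.stronglyMeasurable σ).measurable.ennreal_ofReal.add
      (Lp.stronglyMeasurable τ).measurable.ennreal_ofReal

lemma lintegral_ofReal_le_shiftedFunctional (hε : 0 < ε) (hcM : ∀ x, |c x| ≤ M)
    {σ : Lp ℝ 1 lam} (hσ : 0 ≤ σ) :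
    ∫⁻ x, ENNReal.ofReal (σ x) ∂lam ≤ shiftedFunctional κ lam ε M c D σ := by
  refine le_trans (lintegral_mono_ae ?_) le_self_add
  filter_upwards [(Lp.coeFn_nonneg σ).2 hσ] with x hx
  exact ENNReal.ofReal_le_ofReal (le_shiftedIntegrand hε (hcM x) hx)

/-- Uniform convexity of the shifted functional. -/
lemma shiftedFunctional_midpoint (hε : 0 < ε) (hc : Measurable c) (hcM : ∀ x, |c x| ≤ M)
    (hD : IsConvexPenalty lam D) {σ τ : Lp ℝ 1 lam} (hσ : 0 ≤ σ) (hτ : 0 ≤ τ) {η : ℝ}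
    (hη : 0 ≤ η) :
    shiftedFunctional κ lam ε M c D ((2⁻¹ : ℝ) • (σ + τ)) + ENNReal.ofReal (ε * η / 2) * edist σ τ
      ≤ 2⁻¹ * (shiftedFunctional κ lam ε M c D σ + shiftedFunctional κ lam ε M c D τ)
        + ENNReal.ofReal (ε * η ^ 2 / 2) *
          (shiftedFunctional κ lam ε M c D σ + shiftedFunctional κ lam ε M c D τ) := by
  have hmσ := (Lp.stronglyMeasurable σ).measurable
  have hmτ := (Lp.stronglyMeasurable τ).measurable
  set A : Lp ℝ 1 lam → ℝ≥0∞ := fun σ =>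
    ∫⁻ x, ENNReal.ofReal (shiftedIntegrand κ ε M (c x) (σ x)) ∂lam with hA
  have hmA : ∀ σ : Lp ℝ 1 lam, Measurable fun x =>
      ENNReal.ofReal (shiftedIntegrand κ ε M (c x) (σ x)) := fun σ =>
    (measurable_shiftedIntegrand hc (Lp.stronglyMeasurable _).measurable).ennreal_ofReal
  have key : A ((2⁻¹ : ℝ) • (σ + τ)) + ENNReal.ofReal (ε * η / 2) * edist σ τ
      ≤ 2⁻¹ * (A σ + A τ) + ENNReal.ofReal (ε * η ^ 2 / 2) *
        ((∫⁻ x, ENNReal.ofReal (σ x) ∂lam) + ∫⁻ x, ENNReal.ofReal (τ x) ∂lam) := by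
    rw [← withDensity_enorm_sub_univ, withDensity_apply _ MeasurableSet.univ,
      Measure.restrict_univ, ← lintegral_const_mul _ (by fun_prop), hA]
    dsimp only
    have hm2 := (hmA σ).fun_add (hmA τ)
    rw [← lintegral_add_left (hmA _), ← lintegral_add_left (hmA _), ← lintegral_const_mul _ hm2,
      ← lintegral_add_left hmσ.ennreal_ofReal, ← lintegral_const_mul _
      (hmσ.ennreal_ofReal.fun_add hmτ.ennreal_ofReal), ← lintegral_add_left (hm2.const_mul _)]
    refine lintegral_mono_ae ?_
    filter_upwards [Lp.coeFn_smul (2⁻¹ : ℝ) (σ + τ), Lp.coeFn_add σ τ, (Lp.coeFn_nonneg σ).2 hσ,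
      (Lp.coeFn_nonneg τ).2 hτ] with x h1 h2 h3 h4
    simp only [Pi.zero_apply] at h3 h4
    simp only [h1, Pi.smul_apply, h2, Pi.add_apply, smul_eq_mul]
    have g3 := h3.trans (le_shiftedIntegrand (κ := κ) hε (hcM x) h3)
    have g4 := h4.trans (le_shiftedIntegrand (κ := κ) hε (hcM x) h4)
    have g5 : 0 ≤ 2⁻¹ * (σ x + τ x) := by positivity
    have g6 := g5.trans (le_shiftedIntegrand (κ := κ) hε (hcM x) g5)
    have e2 : (2⁻¹ : ℝ≥0∞) = ENNReal.ofReal 2⁻¹ := by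
      rw [ENNReal.ofReal_inv_of_pos (by norm_num)]; norm_num
    rw [Real.enorm_eq_ofReal_abs, e2, ← ENNReal.ofReal_mul (by positivity),
      ← ENNReal.ofReal_add g6 (by positivity), ← ENNReal.ofReal_add g3 g4,
      ← ENNReal.ofReal_mul (by positivity), ← ENNReal.ofReal_add h3 h4,
      ← ENNReal.ofReal_mul (by positivity), ← ENNReal.ofReal_add (by positivity) (by positivity)]
    exact ENNReal.ofReal_le_ofReal (shiftedIntegrand_midpoint hε h3 h4)
  -- The penalty is only midpoint convex; the L¹ gain comes entirely from the integral part, and the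
  -- masses in the error are bounded by the functional itself.
  have hDm := hD.midpoint (densityMeasure lam σ) (densityMeasure lam τ) inferInstance inferInstance
  rw [← densityMeasure_midpoint hσ hτ] at hDm
  have l1 := lintegral_ofReal_le_shiftedFunctional (κ := κ) (D := D) hε hcM hσ
  have l2 := lintegral_ofReal_le_shiftedFunctional (κ := κ) (D := D) hε hcM hτ
  calc _ = (A ((2⁻¹ : ℝ) • (σ + τ)) + ENNReal.ofReal (ε * η / 2) * edist σ τ)
        + D (densityMeasure lam ((2⁻¹ : ℝ) • (σ + τ))) := by
        unfold shiftedFunctional; rw [add_right_comm]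
    _ ≤ (2⁻¹ * (A σ + A τ) + ENNReal.ofReal (ε * η ^ 2 / 2) *
        ((∫⁻ x, ENNReal.ofReal (σ x) ∂lam) + ∫⁻ x, ENNReal.ofReal (τ x) ∂lam))
        + 2⁻¹ * (D (densityMeasure lam σ) + D (densityMeasure lam τ)) := add_le_add key hDm
    _ = 2⁻¹ * (shiftedFunctional κ lam ε M c D σ + shiftedFunctional κ lam ε M c D τ)
        + ENNReal.ofReal (ε * η ^ 2 / 2) *
        ((∫⁻ x, ENNReal.ofReal (σ x) ∂lam) + ∫⁻ x, ENNReal.ofReal (τ x) ∂lam) := by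
        unfold shiftedFunctional; ring
    _ ≤ _ := by gcongr

end Existence

/-! ### Existence and uniqueness for regularized problems -/

section Existence

variable {α : Type*} [MeasurableSpace α]
variable {κ ε M : ℝ} {lam : Measure α} {c : α → ℝ} {D : Measure α → ℝ≥0∞}

/-- Near-minimizers of the shifted functional are close to each other. -/
lemma edist_le_of_shiftedFunctional_le (hε : 0 < ε) (hc : Measurable c) (hcM : ∀ x, |c x| ≤ M)
    (hD : IsConvexPenalty lam D) {m : ℝ≥0∞} (hm : m ≠ ∞)
    (hmin : ∀ σ : Lp ℝ 1 lam, 0 ≤ σ → m ≤ shiftedFunctional κ lam ε M c D σ) :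
    ∃ C : ℝ≥0∞, C ≠ ∞ ∧ ∀ (n : ℕ) (σ τ : Lp ℝ 1 lam), 0 ≤ σ → 0 ≤ τ →
      shiftedFunctional κ lam ε M c D σ ≤ m + (2⁻¹ ^ n) ^ 2 →
      shiftedFunctional κ lam ε M c D τ ≤ m + (2⁻¹ ^ n) ^ 2 → edist σ τ ≤ C * 2⁻¹ ^ n := by
  have h2 : (2⁻¹ : ℝ≥0∞) = ENNReal.ofReal 2⁻¹ := by
    rw [ENNReal.ofReal_inv_of_pos (by norm_num)]; norm_num
  have h22 : (2 : ℝ≥0∞) * 2⁻¹ = 1 := ENNReal.mul_inv_cancel (by norm_num) (by norm_num)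
  set a := ENNReal.ofReal (ε / 2) with ha
  have ha0 : a ≠ 0 := by simpa [ha] using hε
  have hat : a ≠ ∞ := ENNReal.ofReal_ne_top
  refine ⟨a⁻¹ * (1 + a * (2 * (m + 1))), ENNReal.mul_ne_top (ENNReal.inv_ne_top.2 ha0)
    (ENNReal.add_ne_top.2 ⟨by simp, ENNReal.mul_ne_top hat (ENNReal.mul_ne_top (by simp)
      (ENNReal.add_ne_top.2 ⟨hm, by simp⟩))⟩), fun n σ τ hσ hτ h h' => ?_⟩
  -- The convexity parameter is the square root of the energy gap η². Gap and convexity error are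
  -- then both of order η², the gain is of order η times the distance, and dividing by η bounds the
  -- distance by a multiple of η.
  set η : ℝ≥0∞ := 2⁻¹ ^ n with hη
  have hη1 : η ≤ 1 := pow_le_one₀ zero_le (by simp)
  have hη0 : η ≠ 0 := by simp [hη]
  have hηt : η ≠ ∞ := ne_top_of_le_ne_top (by simp) hη1
  have e : ENNReal.ofReal (2⁻¹ ^ n) = η := by rw [ENNReal.ofReal_pow (by norm_num), ← h2]
  have key := shiftedFunctional_midpoint (κ := κ) hε hc hcM hD hσ hτ (η := 2⁻¹ ^ n) (by positivity)
  have e1 : ENNReal.ofReal (ε * 2⁻¹ ^ n / 2) = a * η := by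
    rw [← e, ha, ← ENNReal.ofReal_mul (by positivity)]; congr 1; ring
  have e2 : ENNReal.ofReal (ε * (2⁻¹ ^ n) ^ 2 / 2) = a * η ^ 2 := by
    rw [← e, ha, ← ENNReal.ofReal_pow (by positivity), ← ENNReal.ofReal_mul (by positivity)]
    congr 1; ring
  rw [e1, e2] at key
  have hmid : (0 : Lp ℝ 1 lam) ≤ (2⁻¹ : ℝ) • (σ + τ) := by
    rw [← Lp.coeFn_nonneg]
    filter_upwards [Lp.coeFn_smul (2⁻¹ : ℝ) (σ + τ), Lp.coeFn_add σ τ, (Lp.coeFn_nonneg σ).2 hσ,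
      (Lp.coeFn_nonneg τ).2 hτ] with x h1 h2 h3 h4
    simp only [Pi.zero_apply] at h3 h4 ⊢
    simp only [h1, Pi.smul_apply, h2, Pi.add_apply, smul_eq_mul]
    positivity
  have hη2 : η ^ 2 ≤ 1 := pow_le_one₀ zero_le hη1
  have h3 : m + a * η * edist σ τ ≤ m + η * (η * (1 + a * (2 * (m + 1)))) := by
    calc _ ≤ 2⁻¹ * (shiftedFunctional κ lam ε M c D σ + shiftedFunctional κ lam ε M c D τ)
        + a * η ^ 2 *
          (shiftedFunctional κ lam ε M c D σ + shiftedFunctional κ lam ε M c D τ) :=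
        le_trans (by gcongr; exact hmin _ hmid) key
      _ ≤ 2⁻¹ * ((m + η ^ 2) + (m + η ^ 2)) + a * η ^ 2 * ((m + 1) + (m + 1)) := by
        gcongr
        · exact h.trans (by gcongr)
        · exact h'.trans (by gcongr)
      _ = (2 * 2⁻¹) * (m + η ^ 2) + a * η ^ 2 * ((m + 1) + (m + 1)) := by ring
      _ = _ := by rw [h22]; ring
  rw [ENNReal.add_le_add_iff_left hm, mul_comm a η, mul_assoc,
    ENNReal.mul_le_mul_iff_right hη0 hηt] at h3
  rw [mul_assoc, mul_comm _ η]
  calc edist σ τ = a⁻¹ * (a * edist σ τ) := by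
        rw [← mul_assoc, ENNReal.inv_mul_cancel ha0 hat, one_mul]
    _ ≤ _ := by gcongr

/-- The shifted functional has a unique minimizer among nonnegative integrable functions, if it is
not identically infinite there. -/
lemma exists_minimizer_shiftedFunctional (hε : 0 < ε) (hc : Measurable c) (hcM : ∀ x, |c x| ≤ M)
    (hD : IsConvexPenalty lam D) {σ₀ : Lp ℝ 1 lam} (h₀ : 0 ≤ σ₀)
    (h₀' : shiftedFunctional κ lam ε M c D σ₀ ≠ ∞) :
    ∃ σ : Lp ℝ 1 lam, 0 ≤ σ ∧ shiftedFunctional κ lam ε M c D σ ≠ ∞ ∧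
      (∀ τ : Lp ℝ 1 lam, 0 ≤ τ →
        shiftedFunctional κ lam ε M c D σ ≤ shiftedFunctional κ lam ε M c D τ) ∧
      ∀ τ : Lp ℝ 1 lam, 0 ≤ τ →
        shiftedFunctional κ lam ε M c D τ ≤ shiftedFunctional κ lam ε M c D σ → τ = σ := by
  set Φ := shiftedFunctional κ lam ε M c D with hΦ
  set m : ℝ≥0∞ := ⨅ σ : {σ : Lp ℝ 1 lam // 0 ≤ σ}, Φ σ with hmdef
  have hmin : ∀ σ : Lp ℝ 1 lam, 0 ≤ σ → m ≤ Φ σ := fun σ hσ =>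
    iInf_le (fun σ : {σ : Lp ℝ 1 lam // 0 ≤ σ} => Φ σ) ⟨σ, hσ⟩
  have hm : m ≠ ∞ := ne_top_of_le_ne_top h₀' (hmin _ h₀)
  obtain ⟨C, hC, hclose⟩ := edist_le_of_shiftedFunctional_le (κ := κ) hε hc hcM hD hm hmin
  have hpow : ∀ n : ℕ, ((2⁻¹ : ℝ≥0∞) ^ n) ^ 2 ≠ 0 := fun n => by simp
  have happ : ∀ n : ℕ, ∃ σ : Lp ℝ 1 lam, 0 ≤ σ ∧ Φ σ ≤ m + (2⁻¹ ^ n) ^ 2 := by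
    intro n
    have : m < m + (2⁻¹ ^ n) ^ 2 := ENNReal.lt_add_right hm (hpow n)
    obtain ⟨σ, hσ⟩ := iInf_lt_iff.1 (hmdef ▸ this)
    exact ⟨σ, σ.2, hσ.le⟩
  choose σs hσs0 hσs using happ
  have hmono : ∀ n k : ℕ, n ≤ k → Φ (σs k) ≤ m + (2⁻¹ ^ n) ^ 2 := fun n k hnk =>
    (hσs k).trans (add_le_add le_rfl (pow_le_pow_left'
      (pow_le_pow_of_le_one zero_le (ENNReal.inv_le_one.2 one_le_two) hnk) 2))
  -- Near-minimizers are geometrically close, so completeness of L¹ does the work of a compactness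
  -- argument.
  have hcau : CauchySeq σs := by
    refine cauchySeq_of_edist_le_geometric_two C hC fun n => ?_
    rw [div_eq_mul_inv, ENNReal.inv_pow]
    exact hclose n _ _ (hσs0 _) (hσs0 _) (hσs n) (hmono n _ n.le_succ)
  obtain ⟨σ, hσ⟩ := cauchySeq_tendsto_of_complete hcau
  have hσ0 : 0 ≤ σ := ge_of_tendsto' hσ hσs0
  have hlim : Tendsto (fun n : ℕ => m + ((2⁻¹ : ℝ≥0∞) ^ n) ^ 2) atTop (𝓝 m) := by
    have h1 : Tendsto (fun n : ℕ => (2⁻¹ : ℝ≥0∞) ^ n) atTop (𝓝 0) :=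
      ENNReal.tendsto_pow_atTop_nhds_zero_of_lt_one (by simp)
    have h2 := (ENNReal.continuous_pow 2).tendsto 0 |>.comp h1
    simpa using (tendsto_const_nhds (x := m)).add h2
  have hle : Φ σ ≤ m := by
    refine ge_of_tendsto' hlim fun n => ?_
    have hcl := (lowerSemicontinuous_iff_isClosed_preimage.1
      (lowerSemicontinuous_shiftedFunctional (κ := κ) (ε := ε) (M := M) hc hD))
      (m + (2⁻¹ ^ n) ^ 2)
    exact hcl.mem_of_tendsto hσ ((eventually_ge_atTop n).mono fun k hk => hmono n k hk)
  refine ⟨σ, hσ0, ne_top_of_le_ne_top hm hle, fun τ hτ => hle.trans (hmin τ hτ),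
    fun τ hτ h => ?_⟩
  -- Two minimizers are near-minimizers at every precision, hence at distance 0.
  have hd : ∀ n : ℕ, edist τ σ ≤ C * 2⁻¹ ^ n := fun n =>
    hclose n _ _ hτ hσ0 ((h.trans hle).trans le_self_add) (hle.trans le_self_add)
  have : Tendsto (fun n : ℕ => C * (2⁻¹ : ℝ≥0∞) ^ n) atTop (𝓝 0) := by
    have h1 : Tendsto (fun n : ℕ => (2⁻¹ : ℝ≥0∞) ^ n) atTop (𝓝 0) :=
      ENNReal.tendsto_pow_atTop_nhds_zero_of_lt_one (by simp)
    simpa using ENNReal.Tendsto.const_mul h1 (Or.inr hC)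
  exact edist_eq_zero.1 (le_antisymm (ge_of_tendsto' this hd) zero_le)

/-- A regularized problem: a linear cost, the entropy, and a penalty. -/
def regularizedObjective (κ : ℝ) (lam : Measure α) (ε : ℝ) (c : α → ℝ) (D : Measure α → ℝ≥0∞)
    (π : Measure α) : EReal :=
  ((∫ x, c x ∂π : ℝ) : EReal) + (ε : EReal) * entropy κ lam π + ((D π : ℝ≥0∞) : EReal)

lemma regularizedObjective_eq_top_of_entropy (hε : 0 < ε) {π : Measure α}
    (h : entropy κ lam π = ⊤) : regularizedObjective κ lam ε c D π = ⊤ := by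
  unfold regularizedObjective
  rw [h, EReal.coe_mul_top_of_pos hε, EReal.coe_add_top, EReal.top_add_of_ne_bot]
  exact EReal.coe_ennreal_ne_bot _

lemma exists_densityMeasure_eq {π : Measure α} [IsFiniteMeasure π] [SigmaFinite lam]
    (h : π ≪ lam) : ∃ σ : Lp ℝ 1 lam, 0 ≤ σ ∧ densityMeasure lam σ = π := by
  have hi : Integrable (fun x => (π.rnDeriv lam x).toReal) lam := Measure.integrable_toReal_rnDeriv
  refine ⟨hi.toL1 _, ?_, ?_⟩
  · rw [← Lp.coeFn_nonneg]
    filter_upwards [hi.coeFn_toL1] with x hx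
    rw [hx]; exact ENNReal.toReal_nonneg
  · conv_rhs => rw [← Measure.withDensity_rnDeriv_eq _ _ h]
    refine withDensity_congr_ae ?_
    filter_upwards [hi.coeFn_toL1, Measure.rnDeriv_lt_top π lam] with x hx ht
    rw [hx, ENNReal.ofReal_toReal ht.ne]

/-- The shift adds the constant `shiftConst` times the finite reference mass, so it does not move
minimizers. If σ log σ is not integrable both sides are `⊤`: cost and mass are integrable, and the
nonnegative shifted integrand has infinite integral. -/
lemma regularizedObjective_densityMeasure [IsFiniteMeasure lam] (hε : 0 < ε) (hc : Measurable c)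
    (hcM : ∀ x, |c x| ≤ M) {σ : Lp ℝ 1 lam} (hσ : 0 ≤ σ) :
    regularizedObjective κ lam ε c D (densityMeasure lam σ)
      = (shiftedFunctional κ lam ε M c D σ : EReal)
        - ((shiftConst κ ε M * lam.real univ : ℝ) : EReal) := by
  set π := densityMeasure lam σ with hπ
  have hmσ : Measurable σ := (Lp.stronglyMeasurable σ).measurable
  have hac : π ≪ lam := withDensity_absolutelyContinuous _ _
  have hrn : ∀ᵐ x ∂lam, (π.rnDeriv lam x).toReal = σ x := by
    filter_upwards [Measure.rnDeriv_withDensity lam hmσ.ennreal_ofReal,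
      (Lp.coeFn_nonneg σ).2 hσ] with x hx h0
    rw [hπ, densityMeasure, hx, ENNReal.toReal_ofReal h0]
  have hiσ : Integrable σ lam := L1.integrable_coeFn σ
  have hcσ : Integrable (fun x => c x * σ x) lam :=
    hiσ.bdd_mul hc.aestronglyMeasurable (Eventually.of_forall hcM)
  have hlog : (fun x => (π.rnDeriv lam x).toReal * Real.log (π.rnDeriv lam x).toReal)
      =ᵐ[lam] fun x => σ x * Real.log (σ x) := by
    filter_upwards [hrn] with x hx
    rw [hx]
  have hcint : ∫ x, c x ∂π = ∫ x, c x * σ x ∂lam := by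
    rw [← integral_rnDeriv_smul hac]
    refine integral_congr_ae ?_
    filter_upwards [hrn] with x hx
    rw [hx, smul_eq_mul, mul_comm]
  have hmass : π.real univ = ∫ x, σ x ∂lam := by
    rw [← mul_one (π.real univ), ← smul_eq_mul, ← integral_const, ← integral_rnDeriv_smul hac]
    refine integral_congr_ae ?_
    filter_upwards [hrn] with x hx
    rw [hx, smul_eq_mul, mul_one]
  have hiff : Integrable (llr π lam) π ↔ Integrable (fun x => σ x * Real.log (σ x)) lam := by
    rw [← integrable_rnDeriv_mul_log_iff hac, integrable_congr hlog]
  unfold regularizedObjective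
  by_cases hint : Integrable (llr π lam) π
  · have hint' := hiff.1 hint
    have hE : ∫ x, llr π lam x ∂π = ∫ x, σ x * Real.log (σ x) ∂lam := by
      rw [← integral_rnDeriv_mul_log hac, integral_congr_ae hlog]
    have hent : entropy κ lam π = ((∫ x, llr π lam x ∂π - κ * π.real univ : ℝ) : EReal) := by
      unfold entropy
      rw [if_pos ⟨hac, hint⟩]
    have hg : Integrable (fun x => shiftedIntegrand κ ε M (c x) (σ x)) lam := by
      unfold shiftedIntegrand
      exact ((hcσ.add (hint'.const_mul ε)).sub (hiσ.const_mul _)).add (integrable_const _)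
    have hg0 : 0 ≤ᵐ[lam] fun x => shiftedIntegrand κ ε M (c x) (σ x) := by
      filter_upwards [(Lp.coeFn_nonneg σ).2 hσ] with x hx
      exact le_trans hx (le_shiftedIntegrand hε (hcM x) hx)
    have hgint : ∫ x, shiftedIntegrand κ ε M (c x) (σ x) ∂lam
        = ∫ x, c x ∂π + ε * (∫ x, llr π lam x ∂π - κ * π.real univ)
          + shiftConst κ ε M * lam.real univ := by
      unfold shiftedIntegrand
      have hi : Integrable (fun x => c x * σ x + ε * (σ x * Real.log (σ x)) - ε * κ * σ x) lam :=
        (hcσ.add (hint'.const_mul ε)).sub (hiσ.const_mul _)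
      rw [integral_add hi (integrable_const _), integral_sub (hcσ.fun_add (hint'.const_mul ε)) (hiσ.const_mul _),
        integral_add hcσ (hint'.const_mul ε), integral_const_mul, integral_const_mul,
        integral_const, hcint, hE, hmass, smul_eq_mul]
      ring
    have h1 : ((∫⁻ x, ENNReal.ofReal (shiftedIntegrand κ ε M (c x) (σ x)) ∂lam : ℝ≥0∞) : EReal)
        = ((∫ x, shiftedIntegrand κ ε M (c x) (σ x) ∂lam : ℝ) : EReal) := by
      rw [← ofReal_integral_eq_lintegral_ofReal hg hg0, EReal.coe_ennreal_ofReal,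
        max_eq_left (integral_nonneg_of_ae hg0)]
    unfold shiftedFunctional
    rw [EReal.coe_ennreal_add, h1, hgint, hent, ← EReal.coe_mul, ← EReal.coe_add, ← hπ]
    generalize (D π : EReal) = d
    set A := ∫ x, c x ∂π + ε * (∫ x, llr π lam x ∂π - κ * π.real univ)
    set B := shiftConst κ ε M * lam.real univ
    induction d using EReal.rec with
    | bot => simp
    | top => simp
    | coe d => norm_cast; ring
  · have hent : entropy κ lam π = ⊤ := by
      unfold entropy
      rw [if_neg fun h => hint h.2]
    have hg : ∫⁻ x, ENNReal.ofReal (shiftedIntegrand κ ε M (c x) (σ x)) ∂lam = ⊤ := by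
      by_contra hne
      apply hint
      rw [hiff]
      have hg0 : 0 ≤ᵐ[lam] fun x => shiftedIntegrand κ ε M (c x) (σ x) := by
        filter_upwards [(Lp.coeFn_nonneg σ).2 hσ] with x hx
        exact le_trans hx (le_shiftedIntegrand hε (hcM x) hx)
      have hg : Integrable (fun x => shiftedIntegrand κ ε M (c x) (σ x)) lam :=
        (lintegral_ofReal_ne_top_iff_integrable
          (measurable_shiftedIntegrand hc hmσ).aestronglyMeasurable hg0).1 hne
      -- Solve the shifted integrand for σ log σ; every other term is integrable.
      have := (((hg.sub (integrable_const (shiftConst κ ε M))).add (hiσ.const_mul (ε * κ))).sub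
        hcσ).const_mul ε⁻¹
      refine this.congr (Eventually.of_forall fun x => ?_)
      simp only [Pi.sub_apply, Pi.add_apply, shiftedIntegrand]
      field_simp
      ring
    unfold shiftedFunctional
    rw [hg, hent, EReal.coe_mul_top_of_pos hε, EReal.coe_add_top, EReal.top_add_of_ne_bot
      (EReal.coe_ennreal_ne_bot _), top_add, EReal.coe_ennreal_top, EReal.top_sub_coe]

/-- Regularized problems have a unique solution if their value is finite. -/
theorem existsUnique_regularizedObjective [IsFiniteMeasure lam] (hε : 0 < ε) (hc : Measurable c)
    (hcM : ∀ x, |c x| ≤ M) (hD : IsConvexPenalty lam D)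
    (hfin : ⨅ π : FiniteMeasure α, regularizedObjective κ lam ε c D π < ⊤) :
    ∃ π' : FiniteMeasure α,
      (⨅ π : FiniteMeasure α, regularizedObjective κ lam ε c D π)
        = regularizedObjective κ lam ε c D π' ∧
      ∀ π : FiniteMeasure α,
        IsMinOn (fun π : FiniteMeasure α => regularizedObjective κ lam ε c D π) univ π ↔
          π = π' := by
  have hrep : ∀ π : FiniteMeasure α, regularizedObjective κ lam ε c D π < ⊤ →
      ∃ σ : Lp ℝ 1 lam, 0 ≤ σ ∧ densityMeasure lam σ = π := by
    intro π hπ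
    apply exists_densityMeasure_eq
    by_contra h
    refine hπ.ne (regularizedObjective_eq_top_of_entropy hε ?_)
    unfold entropy
    rw [if_neg fun h' => h h'.1]
  obtain ⟨π₀, hπ₀⟩ := iInf_lt_iff.1 hfin
  obtain ⟨σ₀, hσ₀, hσπ₀⟩ := hrep π₀ hπ₀
  have h₀ : shiftedFunctional κ lam ε M c D σ₀ ≠ ∞ := by
    intro h
    rw [← hσπ₀, regularizedObjective_densityMeasure hε hc hcM hσ₀, h,
      EReal.coe_ennreal_top, EReal.top_sub_coe] at hπ₀
    exact hπ₀.ne rfl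
  obtain ⟨σ, hσ, hσt, hmin, huniq⟩ := exists_minimizer_shiftedFunctional hε hc hcM hD hσ₀ h₀
  have hle : ∀ π : FiniteMeasure α, regularizedObjective κ lam ε c D (densityMeasure lam σ)
      ≤ regularizedObjective κ lam ε c D π := by
    intro π
    rcases eq_or_ne (regularizedObjective κ lam ε c D π) ⊤ with h | h
    · rw [h]; exact le_top
    obtain ⟨τ, hτ, hτπ⟩ := hrep π h.lt_top
    rw [← hτπ, regularizedObjective_densityMeasure hε hc hcM hσ,
      regularizedObjective_densityMeasure hε hc hcM hτ]
    exact EReal.sub_le_sub (by exact_mod_cast hmin τ hτ) le_rfl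
  refine ⟨⟨densityMeasure lam σ, inferInstance⟩, le_antisymm (iInf_le _ _) (le_iInf hle),
    fun π => ⟨fun h => ?_, fun h => ?_⟩⟩
  · have h1 : regularizedObjective κ lam ε c D π
        ≤ regularizedObjective κ lam ε c D (densityMeasure lam σ) :=
      h (mem_univ (⟨densityMeasure lam σ, inferInstance⟩ : FiniteMeasure α))
    have h2 : regularizedObjective κ lam ε c D (densityMeasure lam σ) < ⊤ := (hle π₀).trans_lt hπ₀
    obtain ⟨τ, hτ, hτπ⟩ := hrep π (h1.trans_lt h2)
    rw [← hτπ, regularizedObjective_densityMeasure hε hc hcM hσ,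
      regularizedObjective_densityMeasure hε hc hcM hτ] at h1
    have h3 := add_le_add_left h1 ((shiftConst κ ε M * lam.real univ : ℝ) : EReal)
    rw [EReal.sub_add_cancel, EReal.sub_add_cancel] at h3
    have h4 := huniq τ hτ (by exact_mod_cast h3)
    apply Subtype.ext
    rw [← h4]
    exact hτπ.symm
  · rw [h]
    exact fun π _ => hle π

/-- In `EReal`, `⊥` absorbs `⊤` under addition; excluding `⊥` ensures that a finite sum of edge
values has finite terms. -/
lemma regularizedObjective_ne_bot (hε : 0 < ε) (π : Measure α) :
    regularizedObjective κ lam ε c D π ≠ ⊥ := by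
  unfold regularizedObjective entropy
  split_ifs
  · rw [← EReal.coe_mul, ← EReal.coe_add, ne_eq, EReal.add_eq_bot_iff]
    exact fun h => h.elim (EReal.coe_ne_bot _) (EReal.coe_ennreal_ne_bot _)
  · rw [EReal.coe_mul_top_of_pos hε, EReal.coe_add_top, EReal.top_add_of_ne_bot
      (EReal.coe_ennreal_ne_bot _)]
    simp

end Existence

/-! ### Edge sums and rooted trees -/

section Trees

variable {N : ℕ} (G : SimpleGraph (Fin N)) [DecidableRel G.Adj]

lemma mem_orderedEdges {e : Fin N × Fin N} : e ∈ orderedEdges G ↔ e.1 < e.2 ∧ G.Adj e.1 e.2 := by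
  simp [orderedEdges]

/-- Products over the ordered edges are products over the edge set. -/
lemma prod_orderedEdges {M : Type*} [CommMonoid M] (f : Sym2 (Fin N) → M) :
    ∏ e ∈ orderedEdges G, f s(e.1, e.2) = ∏ e ∈ G.edgeFinset, f e := by
  refine Finset.prod_bij (fun e _ => s(e.1, e.2)) (fun e he => ?_) (fun e he e' he' h => ?_)
    (fun e he => ?_) (fun _ _ => rfl)
  · simpa using ((mem_orderedEdges G).1 he).2
  · have h1 := ((mem_orderedEdges G).1 he).1
    have h2 := ((mem_orderedEdges G).1 he').1
    rcases Sym2.eq_iff.1 h with h | h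
    · exact Prod.ext h.1 h.2
    · rw [h.1, h.2] at h1
      exact absurd h1 h2.asymm
  · induction e using Sym2.ind with
    | _ i j =>
      have hij : G.Adj i j := by simpa using he
      rcases lt_or_gt_of_ne hij.ne with h | h
      · exact ⟨(i, j), (mem_orderedEdges G).2 ⟨h, hij⟩, rfl⟩
      · exact ⟨(j, i), (mem_orderedEdges G).2 ⟨h, hij.symm⟩, Sym2.eq_swap⟩

lemma sum_orderedEdges {M : Type*} [AddCommMonoid M] (f : Sym2 (Fin N) → M) :
    ∑ e ∈ orderedEdges G, f s(e.1, e.2) = ∑ e ∈ G.edgeFinset, f e :=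
  prod_orderedEdges (M := Multiplicative M) G f

/-- Summing node values over the two ends of all edges. -/
lemma sum_orderedEdges_ends (t : Sym2 (Fin N) → ℝ) (a : Fin N → ℝ) :
    ∑ e ∈ orderedEdges G, t s(e.1, e.2) * (a e.1 + a e.2)
      = ∑ i, a i * ∑ e ∈ G.incidenceFinset i, t e := by
  have h1 : ∀ e ∈ orderedEdges G, t s(e.1, e.2) * (a e.1 + a e.2)
      = ∑ i, if i ∈ s(e.1, e.2) then t s(e.1, e.2) * a i else 0 := by
    intro e he
    have hne : e.1 ≠ e.2 := ((mem_orderedEdges G).1 he).1.ne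
    rw [← Finset.sum_filter]
    have : (Finset.univ.filter fun i => i ∈ s(e.1, e.2)) = {e.1, e.2} := by
      ext i; simp
    rw [this, Finset.sum_pair hne, mul_add]
  rw [Finset.sum_congr rfl h1,
    sum_orderedEdges G (fun e => ∑ i, if i ∈ e then t e * a i else 0), Finset.sum_comm]
  refine Finset.sum_congr rfl fun i _ => ?_
  rw [Finset.mul_sum, ← Finset.sum_filter]
  refine Finset.sum_congr ?_ fun e _ => mul_comm _ _
  ext e
  simp [SimpleGraph.mem_incidenceFinset, SimpleGraph.incidenceSet]

lemma sum_orderedEdges_ends_eq_degree (a : Fin N → ℝ) :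
    ∑ e ∈ orderedEdges G, (a e.1 + a e.2) = ∑ i, a i * (G.degree i : ℝ) := by
  have := sum_orderedEdges_ends G (fun _ => 1) a
  simpa using this

variable {G}

/-- A tree can be rooted at any node. -/
lemma exists_parent (hG : G.IsTree) (r : Fin N) :
    ∃ p : Fin N → Fin N, p r = r ∧ (∀ i, i ≠ r → G.Adj (p i) i ∧ G.dist r (p i) < G.dist r i) ∧
      (∀ a, G.Adj r a → p a = r) ∧
      ∀ f : Sym2 (Fin N) → ℝ≥0∞,
        ∏ e ∈ orderedEdges G, f s(e.1, e.2) = ∏ i ∈ Finset.univ.erase r, f s(p i, i) := by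
  have hex : ∀ i, i ≠ r → ∃ j, G.Adj j i ∧ G.dist r j < G.dist r i := by
    intro i hi
    -- The parent is the second node on a shortest walk to the root.
    obtain ⟨w, hw⟩ := hG.connected.exists_walk_length_eq_dist i r
    cases w with
    | nil => exact absurd rfl hi
    | @cons _ v _ h q =>
      refine ⟨v, h.symm, ?_⟩
      rw [SimpleGraph.dist_comm, SimpleGraph.dist_comm (u := r), ← hw,
        SimpleGraph.Walk.length_cons]
      exact Nat.lt_succ_of_le (SimpleGraph.dist_le q)
  choose! p hp using hex
  let p' : Fin N → Fin N := fun i => if i = r then r else p i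
  have hp' : ∀ i, i ≠ r → G.Adj (p' i) i ∧ G.dist r (p' i) < G.dist r i := by
    intro i hi
    simpa [p', hi] using hp i hi
  -- An edge joining two nodes that are parents of each other would decrease the distance to the
  -- root both ways.
  have hinj : Set.InjOn (fun i => s(p' i, i)) (Finset.univ.erase r : Finset (Fin N)) := by
    intro i hi j hj h
    have hi' : i ≠ r := by simpa using hi
    have hj' : j ≠ r := by simpa using hj
    rcases Sym2.eq_iff.1 h with h | h
    · exact h.2
    · have h1 := (hp' i hi').2
      have h2 := (hp' j hj').2
      rw [h.1] at h1
      rw [← h.2] at h2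
      exact absurd h1 h2.asymm
  have himg : (Finset.univ.erase r).image (fun i => s(p' i, i)) = G.edgeFinset := by
    -- The N - 1 nodes other than the root give distinct edges, and the tree has only N - 1 edges.
    refine Finset.eq_of_subset_of_card_le (fun e he => ?_) ?_
    · obtain ⟨i, hi, rfl⟩ := Finset.mem_image.1 he
      simpa using (hp' i (by simpa using hi)).1
    · rw [Finset.card_image_of_injOn hinj, Finset.card_erase_of_mem (Finset.mem_univ _)]
      have := hG.card_edgeFinset
      simp only [Finset.card_univ]
      omega
  refine ⟨p', by simp [p'], hp', fun a ha => ?_, fun f => ?_⟩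
  · have : s(r, a) ∈ G.edgeFinset := by simpa using ha
    rw [← himg] at this
    obtain ⟨i, hi, h⟩ := Finset.mem_image.1 this
    have hi' : i ≠ r := by simpa using hi
    rcases Sym2.eq_iff.1 h with h | h
    · rw [← h.2, h.1]
    · exact absurd h.2 hi'
  · rw [prod_orderedEdges, ← himg, Finset.prod_image hinj]

/-- This surplus of one node over the edges makes the κ-terms of the tree entropy add up to a single
one. -/
lemma card_orderedEdges (hG : G.IsTree) : (orderedEdges G).card + 1 = N := by
  have h := hG.card_edgeFinset
  have h2 := sum_orderedEdges G (fun _ => 1)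
  simp only [Finset.sum_const, smul_eq_mul, mul_one] at h2
  rw [h2, h, Fintype.card_fin]

end Trees

/-! ### Markov densities on a tree and their edge marginals -/

section Gluing

variable {N : ℕ} {X : Fin N → Type*}

/-- The Markov density on a tree with edge densities `w` and node densities `ρ`. -/
def treeDensity (G : SimpleGraph (Fin N)) [DecidableRel G.Adj] (w : ∀ i j, X i → X j → ℝ≥0∞)
    (ρ : ∀ i, X i → ℝ≥0∞) (x : ∀ i, X i) : ℝ≥0∞ :=
  (∏ i, ρ i (x i)) * ∏ e ∈ orderedEdges G,
    w e.1 e.2 (x e.1) (x e.2) * ((ρ e.1 (x e.1))⁻¹ * (ρ e.2 (x e.2))⁻¹)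

/-- The part of the rooted Markov density that belongs to the nodes in `S`. -/
def rootedDensity (r : Fin N) (p : Fin N → Fin N) (w : ∀ i j, X i → X j → ℝ≥0∞)
    (ρ : ∀ i, X i → ℝ≥0∞) (S : Finset (Fin N)) (x : ∀ i, X i) : ℝ≥0∞ :=
  ρ r (x r) * ∏ i ∈ S.erase r, w (p i) i (x (p i)) (x i) * (ρ (p i) (x (p i)))⁻¹

variable {G : SimpleGraph (Fin N)} {w : ∀ i j, X i → X j → ℝ≥0∞}
  {ρ : ∀ i, X i → ℝ≥0∞}

/-- The Markov density does not depend on the choice of a root. -/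
lemma treeDensity_eq_rootedDensity [DecidableRel G.Adj] {r : Fin N} {p : Fin N → Fin N}
    (hadj : ∀ i, i ≠ r → G.Adj (p i) i)
    (hprod : ∀ f : Sym2 (Fin N) → ℝ≥0∞,
        ∏ e ∈ orderedEdges G, f s(e.1, e.2) = ∏ i ∈ Finset.univ.erase r, f s(p i, i))
    (hsymm : ∀ i j x y, w i j x y = w j i y x) (hfin : ∀ i x, ρ i x ≠ ∞)
    (hzero : ∀ i j, G.Adj i j → ∀ x y, ρ i x = 0 → w i j x y = 0) :
    treeDensity G w ρ = rootedDensity r p w ρ Finset.univ := by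
  ext x
  let f : Sym2 (Fin N) → ℝ≥0∞ := Sym2.lift ⟨fun i j => w i j (x i) (x j) *
    ((ρ i (x i))⁻¹ * (ρ j (x j))⁻¹), fun i j => by
      dsimp only
      rw [hsymm, mul_comm (ρ i (x i))⁻¹]⟩
  have h := hprod f
  simp only [f, Sym2.lift_mk] at h
  unfold treeDensity rootedDensity
  rw [h, ← Finset.mul_prod_erase _ _ (Finset.mem_univ r), mul_assoc, ← Finset.prod_mul_distrib]
  congr 1
  refine Finset.prod_congr rfl fun i hi => ?_
  have hi' : i ≠ r := by simpa using hi
  -- In `ℝ≥0∞` the inverse of 0 is `∞`; where a node density vanishes, so does the edge density, and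
  -- 0 · ∞ = 0 makes both factors vanish.
  by_cases h0 : ρ i (x i) = 0
  · rw [hsymm, hzero i (p i) (hadj i hi').symm _ _ h0]; simp
  · calc _ = (ρ i (x i) * (ρ i (x i))⁻¹) *
          (w (p i) i (x (p i)) (x i) * (ρ (p i) (x (p i)))⁻¹) := by ring
      _ = _ := by rw [ENNReal.mul_inv_cancel h0 (hfin _ _), one_mul]

variable [∀ i, MeasurableSpace (X i)] {lam : ∀ i, Measure (X i)}

lemma measurable_treeDensity [DecidableRel G.Adj] (hw : ∀ i j, Measurable fun z : X i × X j => w i j z.1 z.2)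
    (hρ : ∀ i, Measurable (ρ i)) : Measurable (treeDensity G w ρ) := by
  have h1 : ∀ i, Measurable fun x : ∀ i, X i => ρ i (x i) := fun i =>
    (hρ i).comp (measurable_pi_apply i)
  have h2 : ∀ i j, Measurable fun x : ∀ i, X i => w i j (x i) (x j) := fun i j =>
    (hw i j).comp ((measurable_pi_apply i).prodMk (measurable_pi_apply j))
  unfold treeDensity
  exact (Finset.measurable_prod _ fun i _ => h1 i).mul (Finset.measurable_prod _ fun e _ =>
    (h2 _ _).mul ((h1 _).inv.mul (h1 _).inv))

lemma measurable_rootedDensity {r : Fin N} {p : Fin N → Fin N}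
    (hw : ∀ i j, Measurable fun z : X i × X j => w i j z.1 z.2)
    (hρ : ∀ i, Measurable (ρ i)) (S : Finset (Fin N)) :
    Measurable (rootedDensity r p w ρ S) := by
  have h1 : ∀ i, Measurable fun x : ∀ i, X i => ρ i (x i) := fun i =>
    (hρ i).comp (measurable_pi_apply i)
  have h2 : ∀ i j, Measurable fun x : ∀ i, X i => w i j (x i) (x j) := fun i j =>
    (hw i j).comp ((measurable_pi_apply i).prodMk (measurable_pi_apply j))
  unfold rootedDensity
  exact (h1 r).mul (Finset.measurable_prod _ fun e _ => (h2 _ _).mul (h1 _).inv)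

/-- Integrating out the coordinates in a set of nodes that is closed under passing to children. -/
lemma lmarginal_rootedDensity [∀ i, SigmaFinite (lam i)] {r : Fin N} {p : Fin N → Fin N}
    {d : Fin N → ℕ} (hd : ∀ i, i ≠ r → d (p i) < d i)
    (hadj : ∀ i, i ≠ r → G.Adj (p i) i)
    (hw : ∀ i j, Measurable fun z : X i × X j => w i j z.1 z.2)
    (hρ : ∀ i, Measurable (ρ i))
    (hsymm : ∀ i j x y, w i j x y = w j i y x) (hfin : ∀ i x, ρ i x ≠ ∞)
    (hzero : ∀ i j, G.Adj i j → ∀ x y, ρ i x = 0 → w i j x y = 0)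
    (hint : ∀ i j, G.Adj i j → ∀ x, ∫⁻ y, w i j x y ∂lam j = ρ i x)
    (T : Finset (Fin N)) (hr : r ∉ T) (hT : ∀ i, i ≠ r → p i ∈ T → i ∈ T) :
    (∫⋯∫⁻_T, rootedDensity r p w ρ Finset.univ ∂lam) = rootedDensity r p w ρ Tᶜ := by
  -- The inserted node `a` is nearest to the root. The inner integral over `s` removes its
  -- descendants first, so the coordinate of `a` survives only in the edge to its parent, and `hint`
  -- integrates it out.
  induction T using Finset.induction_on_min_value d with
  | empty => simp
  | insert a s ha hmin ih =>
    have har : a ≠ r := fun h => hr (h ▸ Finset.mem_insert_self _ _)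
    have hrs : r ∉ s := fun h => hr (Finset.mem_insert_of_mem h)
    have hpa : ∀ i, i ≠ r → p i ∈ insert a s → i ≠ a := by
      intro i hi hpi h
      subst h
      rcases Finset.mem_insert.1 hpi with h | h
      · exact (hd i hi).ne (by rw [h])
      · exact (hd i hi).not_ge (hmin _ h)
    have hs : ∀ i, i ≠ r → p i ∈ s → i ∈ s := by
      intro i hi hpi
      have h1 := hT i hi (Finset.mem_insert_of_mem hpi)
      exact (Finset.mem_insert.1 h1).resolve_left (hpa i hi (Finset.mem_insert_of_mem hpi))
    have hpas : p a ∉ insert a s := fun h => hpa a har h rfl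
    have hpaa : p a ≠ a := fun h => hpas (by rw [h]; exact Finset.mem_insert_self _ _)
    have herase : sᶜ.erase r = insert a ((insert a s)ᶜ.erase r) := by
      ext i
      simp only [Finset.mem_erase, Finset.mem_compl, Finset.mem_insert]
      by_cases hia : i = a
      · simp [hia, har, ha]
      · simp [hia]
    ext x
    rw [lmarginal_insert _ (measurable_rootedDensity hw hρ _) ha, ih hrs hs]
    have hupd : ∀ y, rootedDensity r p w ρ sᶜ (Function.update x a y)
        = rootedDensity r p w ρ (insert a s)ᶜ x * (ρ (p a) (x (p a)))⁻¹ *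
          w (p a) a (x (p a)) y := by
      intro y
      unfold rootedDensity
      rw [herase, Finset.prod_insert (by simp), Function.update_of_ne har.symm,
        Function.update_of_ne hpaa, Function.update_self]
      have : ∏ i ∈ (insert a s)ᶜ.erase r, w (p i) i (Function.update x a y (p i))
            (Function.update x a y i) * (ρ (p i) (Function.update x a y (p i)))⁻¹
          = ∏ i ∈ (insert a s)ᶜ.erase r, w (p i) i (x (p i)) (x i) * (ρ (p i) (x (p i)))⁻¹ := by
        refine Finset.prod_congr rfl fun i hi => ?_
        simp only [Finset.mem_erase, Finset.mem_compl] at hi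
        have h1 : i ≠ a := fun h => hi.2 (h ▸ Finset.mem_insert_self _ _)
        have h2 : p i ≠ a := fun h => hi.2 (hT i hi.1 (h ▸ Finset.mem_insert_self _ _))
        rw [Function.update_of_ne h1, Function.update_of_ne h2]
      rw [this]
      ring
    simp_rw [hupd]
    have hwm : Measurable fun y => w (p a) a (x (p a)) y := (hw (p a) a).comp measurable_prodMk_left
    rw [lintegral_const_mul _ hwm, hint _ _ (hadj a har), mul_assoc]
    -- The cancellation fails where the parent density is 0, but there another factor is 0: the root
    -- density, or the edge from the parent to its own parent.
    by_cases h0 : ρ (p a) (x (p a)) = 0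
    · suffices rootedDensity r p w ρ (insert a s)ᶜ x = 0 by rw [this, zero_mul]
      unfold rootedDensity
      by_cases hpr : p a = r
      · have h0' : ρ r (x r) = 0 := by rw [← hpr]; exact h0
        rw [h0', zero_mul]
      · rw [Finset.prod_eq_zero (i := p a) (by simpa [hpr] using hpas), mul_zero]
        rw [hsymm, hzero _ _ (hadj _ hpr).symm _ _ h0, zero_mul]
    · rw [ENNReal.inv_mul_cancel h0 (hfin _ _), mul_one]

/-- The marginals of the Markov density on the edges. -/
lemma lmarginal_treeDensity [DecidableRel G.Adj] [∀ i, SigmaFinite (lam i)] (hG : G.IsTree)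
    (hw : ∀ i j, Measurable fun z : X i × X j => w i j z.1 z.2)
    (hρ : ∀ i, Measurable (ρ i))
    (hsymm : ∀ i j x y, w i j x y = w j i y x) (hfin : ∀ i x, ρ i x ≠ ∞)
    (hzero : ∀ i j, G.Adj i j → ∀ x y, ρ i x = 0 → w i j x y = 0)
    (hint : ∀ i j, G.Adj i j → ∀ x, ∫⁻ y, w i j x y ∂lam j = ρ i x)
    {r a : Fin N} (hra : G.Adj r a) :
    (∫⋯∫⁻_{r, a}ᶜ, treeDensity G w ρ ∂lam) = fun x => w r a (x r) (x a) := by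
  -- Rooted at `r`, the node `a` is a child of the root, so the complement of the edge is closed
  -- under passing to children and can be integrated out.
  obtain ⟨p, hpr, hp, hpa, hprod⟩ := exists_parent hG r
  rw [treeDensity_eq_rootedDensity (fun i hi => (hp i hi).1) hprod hsymm hfin hzero,
    lmarginal_rootedDensity (d := G.dist r) (fun i hi => (hp i hi).2) (fun i hi => (hp i hi).1) hw
      hρ hsymm hfin hzero hint _ (by simp) ?_]
  · ext x
    unfold rootedDensity
    have : ({r, a}ᶜᶜ : Finset (Fin N)).erase r = {a} := by
      rw [compl_compl, Finset.erase_insert (by simpa using hra.ne)]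
    rw [this, Finset.prod_singleton, hpa a hra]
    by_cases h0 : ρ r (x r) = 0
    · rw [h0, zero_mul, hzero _ _ hra _ _ h0]
    · rw [mul_left_comm, ENNReal.mul_inv_cancel h0 (hfin _ _), mul_one]
  · intro i hi hpi
    simp only [Finset.mem_compl, Finset.mem_insert, Finset.mem_singleton, not_or] at hpi ⊢
    exact ⟨hi, fun h => hpi.1 (h ▸ hpa a hra)⟩

/-- Integrals of functions of two coordinates against a density. -/
lemma lintegral_pi_mul_eq [∀ i, SigmaFinite (lam i)] [∀ i, Nonempty (X i)] {r a : Fin N}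
    (hra : r ≠ a) {q : (∀ i, X i) → ℝ≥0∞} (hq : Measurable q) {h : X r × X a → ℝ≥0∞}
    (hh : Measurable h) (hqh : (∫⋯∫⁻_{r, a}ᶜ, q ∂lam) = fun x => h (x r, x a))
    {g : X r × X a → ℝ≥0∞} (hg : Measurable g) :
    ∫⁻ x, g (x r, x a) * q x ∂Measure.pi lam = ∫⁻ z, g z * h z ∂(lam r).prod (lam a) := by
  let x₀ : ∀ i, X i := fun i => Classical.arbitrary _
  have hpair : Measurable fun x : ∀ i, X i => (x r, x a) :=
    (measurable_pi_apply r).prodMk (measurable_pi_apply a)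
  have hF : Measurable fun x : ∀ i, X i => g (x r, x a) * q x := (hg.comp hpair).mul hq
  have hgh : Measurable fun x : ∀ i, X i => g (x r, x a) * h (x r, x a) :=
    (hg.comp hpair).mul (hh.comp hpair)
  have hT : (∫⋯∫⁻_{r, a}ᶜ, fun x => g (x r, x a) * q x ∂lam)
      = fun x => g (x r, x a) * h (x r, x a) := by
    ext x
    have h2 := congrFun hqh x
    simp only [lmarginal] at h2 ⊢
    have hqm : Measurable fun y : ∀ i : ({r, a}ᶜ : Finset (Fin N)), X i =>
        q (Function.updateFinset x {r, a}ᶜ y) := hq.comp measurable_updateFinset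
    rw [← h2, ← lintegral_const_mul _ hqm]
    refine lintegral_congr fun y => ?_
    simp [Function.updateFinset]
  rw [lintegral_eq_lmarginal_univ x₀, ← Finset.union_compl {r, a},
    lmarginal_union _ _ hF disjoint_compl_right, hT,
    lmarginal_insert _ hgh (by simpa using hra),
    lintegral_prod (fun z => g z * h z) (hg.mul hh).aemeasurable]
  refine lintegral_congr fun u => ?_
  rw [lmarginal_singleton]
  refine lintegral_congr fun v => ?_
  simp [Function.update_of_ne hra]

end Gluing

/-! ### Marginal densities of a two-marginal plan -/

section TwoMarginals

variable {α β : Type*} [MeasurableSpace α] [MeasurableSpace β] {lam : Measure α} {lam' : Measure β}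
  {π : Measure (α × β)}

lemma map_fst_absolutelyContinuous (h : π ≪ lam.prod lam') : π.map Prod.fst ≪ lam :=
  (h.map measurable_fst).trans Measure.quasiMeasurePreserving_fst.absolutelyContinuous

lemma map_snd_absolutelyContinuous [SFinite lam'] (h : π ≪ lam.prod lam') : π.map Prod.snd ≪ lam' :=
  (h.map measurable_snd).trans Measure.quasiMeasurePreserving_snd.absolutelyContinuous

variable [IsFiniteMeasure lam] [IsFiniteMeasure lam'] [IsFiniteMeasure π]

/-- Partial integrals of a density are the density of the first marginal. -/
lemma setLIntegral_rnDeriv_fst (h : π ≪ lam.prod lam') {B : Set β} (hB : MeasurableSet B)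
    (hBπ : π.map Prod.snd Bᶜ = 0) :
    ∀ᵐ x ∂lam, ∫⁻ y in B, π.rnDeriv (lam.prod lam') (x, y) ∂lam'
      = (π.map Prod.fst).rnDeriv lam x := by
  have hm := Measure.measurable_rnDeriv π (lam.prod lam')
  refine ae_eq_of_forall_setLIntegral_eq_of_sigmaFinite hm.lintegral_prod_right'
    (Measure.measurable_rnDeriv _ _) fun s hs _ => ?_
  rw [Measure.setLIntegral_rnDeriv (map_fst_absolutelyContinuous h),
    Measure.map_apply measurable_fst hs, ← lintegral_prod _ hm.aemeasurable, Measure.prod_restrict,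
    Measure.setLIntegral_rnDeriv h]
  rw [Measure.map_apply measurable_snd hB.compl] at hBπ
  have : s ×ˢ B = Prod.fst ⁻¹' s ∩ (Prod.snd ⁻¹' Bᶜ)ᶜ := by ext z; simp
  rw [this, measure_inter_conull (by simpa using hBπ)]

/-- Partial integrals of a density are the density of the second marginal. -/
lemma setLIntegral_rnDeriv_snd (h : π ≪ lam.prod lam') {B : Set α} (hB : MeasurableSet B)
    (hBπ : π.map Prod.fst Bᶜ = 0) :
    ∀ᵐ y ∂lam', ∫⁻ x in B, π.rnDeriv (lam.prod lam') (x, y) ∂lam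
      = (π.map Prod.snd).rnDeriv lam' y := by
  have hm := Measure.measurable_rnDeriv π (lam.prod lam')
  refine ae_eq_of_forall_setLIntegral_eq_of_sigmaFinite hm.lintegral_prod_left'
    (Measure.measurable_rnDeriv _ _) fun s hs _ => ?_
  rw [Measure.setLIntegral_rnDeriv (map_snd_absolutelyContinuous h),
    Measure.map_apply measurable_snd hs, ← lintegral_prod_symm _ hm.aemeasurable,
    Measure.prod_restrict, Measure.setLIntegral_rnDeriv h]
  rw [Measure.map_apply measurable_fst hB.compl] at hBπ
  have : B ×ˢ s = Prod.snd ⁻¹' s ∩ (Prod.fst ⁻¹' Bᶜ)ᶜ := by ext z; simp [and_comm]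
  rw [this, measure_inter_conull (by simpa using hBπ)]

end TwoMarginals

/-! ### Gluing consistent edge plans -/

section Gluing

variable {N : ℕ} {X : Fin N → Type*} [∀ i, MeasurableSpace (X i)]

/-- Families of plans on the edges of a graph that have common marginals on the nodes. -/
structure IsConsistent (G : SimpleGraph (Fin N)) (P : ∀ i, Measure (X i))
    (Pe : ∀ i j, Measure (X i × X j)) : Prop where
  fst : ∀ i j, i < j → G.Adj i j → (Pe i j).map Prod.fst = P i
  snd : ∀ i j, i < j → G.Adj i j → (Pe i j).map Prod.snd = P j

/-- The densities of edge plans, with the two ends of an edge in any order. -/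
def edgeDensity (lam : ∀ i, Measure (X i)) (Pe : ∀ i j, Measure (X i × X j)) (i j : Fin N)
    (x : X i) (y : X j) : ℝ≥0∞ :=
  if i < j then (Pe i j).rnDeriv ((lam i).prod (lam j)) (x, y)
  else if j < i then (Pe j i).rnDeriv ((lam j).prod (lam i)) (y, x) else 0

/-- The density of the Markov plan with prescribed edge plans. -/
def gluedDensity (G : SimpleGraph (Fin N)) [DecidableRel G.Adj] (lam : ∀ i, Measure (X i))
    (P : ∀ i, Measure (X i)) (Pe : ∀ i j, Measure (X i × X j)) : (∀ i, X i) → ℝ≥0∞ :=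
  treeDensity G (edgeDensity lam Pe) fun i => (P i).rnDeriv (lam i)

variable {G : SimpleGraph (Fin N)} {lam : ∀ i, Measure (X i)}
  {P : ∀ i, Measure (X i)} {Pe : ∀ i j, Measure (X i × X j)}

lemma edgeDensity_symm (i j : Fin N) (x : X i) (y : X j) :
    edgeDensity lam Pe i j x y = edgeDensity lam Pe j i y x := by
  unfold edgeDensity
  rcases lt_trichotomy i j with h | h | h
  · simp [h, h.not_gt]
  · simp [h]
  · simp [h, h.not_gt]

lemma measurable_edgeDensity (i j : Fin N) :
    Measurable fun z : X i × X j => edgeDensity lam Pe i j z.1 z.2 := by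
  unfold edgeDensity
  split_ifs
  · exact Measure.measurable_rnDeriv _ _
  · exact (Measure.measurable_rnDeriv _ _).comp measurable_swap
  · exact measurable_const

lemma IsConsistent.mass_eq (h : IsConsistent G P Pe) {i j : Fin N} (hij : G.Adj i j) :
    P i univ = P j univ := by
  have key : ∀ i j, i < j → G.Adj i j → P i univ = P j univ := by
    intro i j hlt hij
    rw [← h.fst i j hlt hij, ← h.snd i j hlt hij, Measure.map_apply measurable_fst .univ,
      Measure.map_apply measurable_snd .univ, preimage_univ, preimage_univ]
  rcases lt_or_gt_of_ne hij.ne with hlt | hlt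
  · exact key i j hlt hij
  · exact (key j i hlt hij.symm).symm

lemma IsConsistent.mass_eq_of_connected (h : IsConsistent G P Pe) (hG : G.Connected)
    (i j : Fin N) : P i univ = P j univ := by
  obtain ⟨w⟩ := hG.preconnected i j
  induction w with
  | nil => rfl
  | cons hadj _ ih => exact (h.mass_eq hadj).trans ih

lemma IsConsistent.edge_mass_eq (h : IsConsistent G P Pe) {i j : Fin N} (hlt : i < j)
    (hij : G.Adj i j) : Pe i j univ = P i univ := by
  rw [← h.fst i j hlt hij, Measure.map_apply measurable_fst .univ, preimage_univ]

lemma IsConsistent.node_absolutelyContinuous (h : IsConsistent G P Pe)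
    [∀ i, IsFiniteMeasure (lam i)]
    (hac : ∀ i j, i < j → G.Adj i j → Pe i j ≪ (lam i).prod (lam j)) {i j : Fin N}
    (hij : G.Adj i j) : P i ≪ lam i := by
  rcases lt_or_gt_of_ne hij.ne with hlt | hlt
  · rw [← h.fst i j hlt hij]
    exact map_fst_absolutelyContinuous (hac i j hlt hij)
  · rw [← h.snd j i hlt hij.symm]
    exact map_snd_absolutelyContinuous (hac j i hlt hij.symm)

/-- Edge plans on a tree with common marginals are the marginals of the Markov plan. -/
theorem IsConsistent.exists_glued [DecidableRel G.Adj] (h : IsConsistent G P Pe) [∀ i, IsFiniteMeasure (lam i)]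
    [∀ i, IsFiniteMeasure (P i)] [∀ i j, IsFiniteMeasure (Pe i j)] (hG : G.IsTree)
    (hdeg : ∀ i, ∃ j, G.Adj i j)
    (hac : ∀ i j, i < j → G.Adj i j → Pe i j ≪ (lam i).prod (lam j)) :
    ∃ Q : Measure (∀ i, X i), IsFiniteMeasure Q ∧ Q ≪ Measure.pi lam ∧
      (∀ i j, i < j → G.Adj i j → Q.map (fun x => (x i, x j)) = Pe i j) ∧
      Q.rnDeriv (Measure.pi lam) =ᵐ[Measure.pi lam] gluedDensity G lam P Pe := by
  classical
  obtain ⟨i₀⟩ : Nonempty (Fin N) := hG.connected.nonempty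
  -- Iterated integrals need a base point. If one space is empty, all the plans have mass 0 and the
  -- zero measure glues them.
  by_cases hX : ∀ i, Nonempty (X i)
  swap
  · obtain ⟨k, hk⟩ := not_forall.1 hX
    rw [not_nonempty_iff] at hk
    have hPk : P k univ = 0 := by rw [univ_eq_empty_iff.2 hk, measure_empty]
    have : IsEmpty (∀ i, X i) := ⟨fun x => hk.elim (x k)⟩
    refine ⟨0, inferInstance, .zero _, fun i j hlt hij => ?_, ?_⟩
    · rw [Measure.map_zero, eq_comm, ← Measure.measure_univ_eq_zero, h.edge_mass_eq hlt hij,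
        h.mass_eq_of_connected hG.connected i k, hPk]
    · exact Eventually.of_forall fun x => isEmptyElim x
  have hPac : ∀ i, P i ≪ lam i := fun i =>
    (hdeg i).elim fun j hj => h.node_absolutelyContinuous hac hj
  set ρ : ∀ i, X i → ℝ≥0∞ := fun i => (P i).rnDeriv (lam i) with hρ
  have hρm : ∀ i, Measurable (ρ i) := fun i => Measure.measurable_rnDeriv _ _
  set w := edgeDensity lam Pe with hw
  have hwm : ∀ i j, Measurable fun z : X i × X j => w i j z.1 z.2 := measurable_edgeDensity
  have hwm' : ∀ i j x, Measurable fun y => w i j x y := fun i j x =>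
    (hwm i j).comp measurable_prodMk_left
  let B : ∀ i, Set (X i) := fun i => {x | ρ i x ≠ 0} ∩ {x | ρ i x ≠ ∞}
  have hBm : ∀ i, MeasurableSet (B i) := fun i =>
    ((hρm i) (measurableSet_singleton 0)).compl.inter ((hρm i) (measurableSet_singleton ∞)).compl
  have hBP : ∀ i, ∀ᵐ x ∂P i, x ∈ B i := by
    intro i
    filter_upwards [Measure.rnDeriv_pos (hPac i),
      (hPac i).ae_le (Measure.rnDeriv_ne_top (P i) (lam i))]
      with x h1 h2
    exact ⟨h1.ne', h2⟩
  have hwB : ∀ i j, G.Adj i j → ∀ᵐ x ∂lam i, ∫⁻ y in B j, w i j x y ∂lam j = ρ i x := by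
    intro i j hij
    rcases lt_or_gt_of_ne hij.ne with hlt | hlt
    · have := setLIntegral_rnDeriv_fst (hac i j hlt hij) (hBm j)
        (by rw [h.snd i j hlt hij]; exact hBP j)
      rw [h.fst i j hlt hij] at this
      simpa [hw, edgeDensity, hlt] using this
    · have := setLIntegral_rnDeriv_snd (hac j i hlt hij.symm) (hBm j)
        (by rw [h.fst j i hlt hij.symm]; exact hBP j)
      rw [h.snd j i hlt hij.symm] at this
      simpa [hw, edgeDensity, hlt, hlt.not_gt] using this
  -- The marginal identities hold only a.e., while integrating out needs them at every point;
  -- truncating to `A` achieves this. The condition integrates over `B j`, so the definition is not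
  -- circular, and it persists after truncation because `A j` and `B j` agree a.e.
  let A : ∀ i, Set (X i) := fun i =>
    B i ∩ ⋂ j, {x | G.Adj i j → ∫⁻ y in B j, w i j x y ∂lam j = ρ i x}
  have hAm : ∀ i, MeasurableSet (A i) := by
    intro i
    refine (hBm i).inter (MeasurableSet.iInter fun j => ?_)
    by_cases hij : G.Adj i j
    · simp only [hij, true_imp_iff]
      exact measurableSet_eq_fun (hwm i j).lintegral_prod_right' (hρm i)
    · simp [hij]
  have hAB : ∀ i, ∀ᵐ x ∂lam i, x ∈ B i → x ∈ A i := by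
    intro i
    have : ∀ᵐ x ∂lam i, ∀ j, G.Adj i j → ∫⁻ y in B j, w i j x y ∂lam j = ρ i x := by
      rw [ae_all_iff]
      intro j
      by_cases hij : G.Adj i j
      · simpa [hij] using hwB i j hij
      · simp [hij]
    filter_upwards [this] with x hx hxB
    exact ⟨hxB, mem_iInter.2 hx⟩
  have hAP : ∀ i, ∀ᵐ x ∂P i, x ∈ A i := by
    intro i
    filter_upwards [hBP i, (hPac i).ae_le (hAB i)] with x h1 h2
    exact h2 h1
  let w' : ∀ i j, X i → X j → ℝ≥0∞ := fun i j x y => if x ∈ A i ∧ y ∈ A j then w i j x y else 0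
  let ρ' : ∀ i, X i → ℝ≥0∞ := fun i => (A i).indicator (ρ i)
  have hw'm : ∀ i j, Measurable fun z : X i × X j => w' i j z.1 z.2 := fun i j =>
    Measurable.ite ((hAm i).prod (hAm j)) (hwm i j) measurable_const
  have hρ'm : ∀ i, Measurable (ρ' i) := fun i => (hρm i).indicator (hAm i)
  have hsymm : ∀ i j x y, w' i j x y = w' j i y x := by
    intro i j x y
    simp only [w', and_comm (a := x ∈ A i), hw, edgeDensity_symm i j]
  have hfin : ∀ i x, ρ' i x ≠ ∞ := by
    intro i x
    by_cases hx : x ∈ A i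
    · simpa [ρ', hx] using hx.1.2
    · simp [ρ', hx]
  have hzero : ∀ i j, G.Adj i j → ∀ x y, ρ' i x = 0 → w' i j x y = 0 := by
    intro i j _ x y h0
    have : x ∉ A i := fun hx => hx.1.1 (by simpa [ρ', hx] using h0)
    simp [w', this]
  have hint : ∀ i j, G.Adj i j → ∀ x, ∫⁻ y, w' i j x y ∂lam j = ρ' i x := by
    intro i j hij x
    by_cases hx : x ∈ A i
    · have e : (fun y => w' i j x y) = (A j).indicator (fun y => w i j x y) := by
        ext y; simp [w', hx, indicator]
      rw [e, lintegral_indicator (hAm j)]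
      have : A j =ᵐ[lam j] B j := by
        filter_upwards [hAB j] with y hy
        exact propext ⟨fun h => h.1, hy⟩
      rw [setLIntegral_congr this]
      simpa [ρ', hx] using mem_iInter.1 hx.2 j hij
    · simp [w', ρ', hx]
  set q := treeDensity G w' ρ' with hq
  have hqm : Measurable q := measurable_treeDensity hw'm hρ'm
  have hpair : ∀ i j, i < j → G.Adj i j →
      ((Measure.pi lam).withDensity q).map (fun x => (x i, x j)) = Pe i j := by
    intro i j hlt hij
    have hpm : Measurable fun x : ∀ i, X i => (x i, x j) :=
      (measurable_pi_apply i).prodMk (measurable_pi_apply j)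
    -- Truncation leaves the edge plans unchanged, since their marginals are carried by the sets
    -- `A`.
    have e1 : Pe i j = ((lam i).prod (lam j)).withDensity fun z => w' i j z.1 z.2 := by
      have e : (fun z : X i × X j => w' i j z.1 z.2)
          = (A i ×ˢ A j).indicator ((Pe i j).rnDeriv ((lam i).prod (lam j))) := by
        ext z; simp [w', indicator, hw, edgeDensity, hlt]
      rw [e, withDensity_indicator ((hAm i).prod (hAm j)), ← restrict_withDensity
        ((hAm i).prod (hAm j)), Measure.withDensity_rnDeriv_eq _ _ (hac i j hlt hij),
        Measure.restrict_eq_self_of_ae_mem]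
      have a1 := hAP i
      have a2 := hAP j
      rw [← h.fst i j hlt hij] at a1
      rw [← h.snd i j hlt hij] at a2
      filter_upwards [ae_of_ae_map measurable_fst.aemeasurable a1,
        ae_of_ae_map measurable_snd.aemeasurable a2] with z h1 h2
      exact ⟨h1, h2⟩
    rw [e1]
    ext s hs
    rw [Measure.map_apply hpm hs, withDensity_apply _ (hpm hs), withDensity_apply _ hs,
      ← lintegral_indicator (hpm hs), ← lintegral_indicator hs]
    have := lintegral_pi_mul_eq hlt.ne hqm (hw'm i j)
      (lmarginal_treeDensity hG hw'm hρ'm hsymm hfin hzero hint hij)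
      (g := s.indicator 1) (measurable_one.indicator hs)
    convert this using 2
    · ext x; simp [indicator]
    · ext z; simp [indicator]
  refine ⟨(Measure.pi lam).withDensity q, ?_, withDensity_absolutelyContinuous _ _, hpair, ?_⟩
  · obtain ⟨i, j, hlt, hij⟩ : ∃ i j, i < j ∧ G.Adj i j := by
      obtain ⟨j, hj⟩ := hdeg i₀
      rcases lt_or_gt_of_ne hj.ne with hlt | hlt
      · exact ⟨_, _, hlt, hj⟩
      · exact ⟨_, _, hlt, hj.symm⟩
    have := hpair i j hlt hij
    constructor
    have hpm : Measurable fun x : ∀ i, X i => (x i, x j) :=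
      (measurable_pi_apply i).prodMk (measurable_pi_apply j)
    rw [← preimage_univ (f := fun x : ∀ i, X i => (x i, x j)), ← Measure.map_apply hpm .univ, this]
    exact measure_lt_top _ _
  · refine (Measure.rnDeriv_withDensity _ hqm).trans ?_
    have a1 : ∀ᵐ x ∂Measure.pi lam, ∀ i, x i ∈ B i → x i ∈ A i := by
      rw [ae_all_iff]
      exact fun i => (Measure.quasiMeasurePreserving_eval lam i).ae (hAB i)
    have a2 : ∀ᵐ x ∂Measure.pi lam, ∀ i, ρ i (x i) ≠ ∞ := by
      rw [ae_all_iff]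
      exact fun i => (Measure.quasiMeasurePreserving_eval lam i).ae (Measure.rnDeriv_ne_top _ _)
    filter_upwards [a1, a2] with x h1 h2
    change treeDensity G w' ρ' x = treeDensity G w ρ x
    by_cases hx : ∀ i, x i ∈ A i
    · simp [treeDensity, w', ρ', hx]
    · obtain ⟨i, hi⟩ := not_forall.1 hx
      -- Outside the null sets, leaving `A i` means that the node density is 0, so both products
      -- vanish.
      have h0 : ρ i (x i) = 0 := by
        by_contra h0
        exact hi (h1 i ⟨h0, h2 i⟩)
      have h0' : ρ' i (x i) = 0 := by simp [ρ', hi]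
      unfold treeDensity
      rw [Finset.prod_eq_zero (Finset.mem_univ i) h0', Finset.prod_eq_zero (Finset.mem_univ i) h0,
        zero_mul, zero_mul]

end Gluing

/-! ### Entropy of images and Gibbs' inequality -/

section Entropy

variable {α β : Type*} [MeasurableSpace α] [MeasurableSpace β]

lemma sub_one_le_mul_log {s : ℝ} (hs : 0 ≤ s) : s - 1 ≤ s * Real.log s := by
  have := mul_le_mul_log_sub_add_exp hs 0
  simp only [mul_zero, Real.exp_zero] at this
  linarith

/-- The image of a plan of finite entropy has finite entropy. -/
lemma integrable_llr_map {lam π : Measure α} {lam' : Measure β} [IsFiniteMeasure lam]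
    [IsFiniteMeasure lam'] [IsFiniteMeasure π] {f : α → β} (hf : Measurable f) {C : ℝ≥0∞}
    (hC : C ≠ ∞) (hmap : lam.map f = C • lam') (hac : π ≪ lam) (hint : Integrable (llr π lam) π) :
    π.map f ≪ lam' ∧ Integrable (llr (π.map f) lam') (π.map f) := by
  have hac' : π.map f ≪ lam' :=
    (hac.map hf).trans (hmap ▸ Measure.smul_absolutelyContinuous)
  refine ⟨hac', ?_⟩
  set P := π.map f with hP
  set r : β → ℝ := fun y => (P.rnDeriv lam' y).toReal with hr
  have hrm : Measurable r := (Measure.measurable_rnDeriv _ _).ennreal_toReal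
  have hr0 : ∀ y, 0 ≤ r y := fun y => ENNReal.toReal_nonneg
  have hri : Integrable r lam' := Measure.integrable_toReal_rnDeriv
  have hrf : Integrable (fun x => r (f x)) lam := by
    have : Integrable r (lam.map f) := by rw [hmap]; exact hri.smul_measure hC
    exact this.comp_measurable hf
  set σ : α → ℝ := fun x => (π.rnDeriv lam x).toReal with hσ
  have hσ0 : ∀ x, 0 ≤ σ x := fun x => ENNReal.toReal_nonneg
  have hσm : Measurable σ := (Measure.measurable_rnDeriv _ _).ennreal_toReal
  have hσi : Integrable (fun x => σ x * Real.log (σ x)) lam :=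
    (integrable_rnDeriv_mul_log_iff hac).2 hint
  -- Young's inequality bounds σ L(f) by σ log σ + r(f) + 1, using exp L ≤ r + 1; r(f) is integrable
  -- because the image of `lam` is a finite multiple of `lam'`. Only this positive part needs care,
  -- since s log s ≥ -1.
  set L : β → ℝ := fun y => max 0 (Real.log (r y)) with hL
  have hLm : Measurable L := measurable_const.max hrm.log
  have h1 : Integrable (fun x => σ x • L (f x)) lam := by
    refine Integrable.mono' ((hσi.add hrf).add (integrable_const (1 : ℝ)))
      (hσm.smul (hLm.comp hf)).aestronglyMeasurable (Eventually.of_forall fun x => ?_)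
    have h := mul_le_mul_log_sub_add_exp (hσ0 x) (L (f x))
    have he : Real.exp (L (f x)) ≤ r (f x) + 1 := by
      simp only [hL]
      rcases le_total (Real.log (r (f x))) 0 with h | h
      · rw [max_eq_left h, Real.exp_zero]; linarith [hr0 (f x)]
      · rw [max_eq_right h]
        rcases (hr0 (f x)).eq_or_lt with h0 | h0
        · rw [← h0]; simp
        · rw [Real.exp_log h0]; linarith
    have hnn : 0 ≤ σ x * L (f x) := mul_nonneg (hσ0 x) (le_max_left _ _)
    rw [smul_eq_mul, Real.norm_of_nonneg hnn]
    simp only [Pi.add_apply]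
    linarith [hσ0 x]
  have h2 : Integrable L P := by
    rw [hP, integrable_map_measure hLm.aestronglyMeasurable hf.aemeasurable]
    exact (integrable_rnDeriv_smul_iff hac).1 h1
  have h3 : Integrable (fun y => r y • L y) lam' := (integrable_rnDeriv_smul_iff hac').2 h2
  rw [← integrable_rnDeriv_mul_log_iff hac']
  refine Integrable.mono' (h3.add (integrable_const (1 : ℝ)))
    (hrm.mul hrm.log).aestronglyMeasurable (Eventually.of_forall fun y => ?_)
  change |r y * Real.log (r y)| ≤ r y * L y + 1
  simp only [hL]
  rcases le_total (Real.log (r y)) 0 with h | h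
  · rw [max_eq_left h, abs_of_nonpos (mul_nonpos_of_nonneg_of_nonpos (hr0 y) h)]
    linarith [sub_one_le_mul_log (hr0 y), hr0 y]
  · rw [max_eq_right h, abs_of_nonneg (mul_nonneg (hr0 y) h)]
    linarith

lemma ae_toReal_rnDeriv_pos {π ν : Measure α} [IsFiniteMeasure π] [SigmaFinite ν] (h : π ≪ ν) :
    ∀ᵐ x ∂π, 0 < (π.rnDeriv ν x).toReal := by
  filter_upwards [Measure.rnDeriv_pos h, h.ae_le (Measure.rnDeriv_ne_top π ν)] with x h1 h2
  exact ENNReal.toReal_pos h1.ne' h2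

/-- Gibbs' inequality. -/
lemma integral_llr_le_integral_llr {ν π Q : Measure α} [IsFiniteMeasure ν] [IsFiniteMeasure π]
    [IsFiniteMeasure Q] (hπ : π ≪ ν) (hQ : Q ≪ ν) (hmass : Q univ = π univ)
    (hpos : ∀ᵐ x ∂π, 0 < (Q.rnDeriv ν x).toReal) (hi : Integrable (llr π ν) π)
    (hi' : Integrable (llr Q ν) π) : ∫ x, llr Q ν x ∂π ≤ ∫ x, llr π ν x ∂π := by
  have hpos' : ∀ᵐ x ∂ν, π.rnDeriv ν x ≠ 0 → 0 < (Q.rnDeriv ν x).toReal := by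
    rw [← Measure.withDensity_rnDeriv_eq _ _ hπ] at hpos
    exact (ae_withDensity_iff (Measure.measurable_rnDeriv _ _)).1 hpos
  have j1 := (integrable_rnDeriv_smul_iff hπ).2 hi
  have j2 := (integrable_rnDeriv_smul_iff hπ).2 hi'
  have k1 : Integrable (fun x => (π.rnDeriv ν x).toReal) ν := Measure.integrable_toReal_rnDeriv
  have k2 : Integrable (fun x => (Q.rnDeriv ν x).toReal) ν := Measure.integrable_toReal_rnDeriv
  rw [← integral_rnDeriv_smul hπ, ← integral_rnDeriv_smul hπ]
  -- Pointwise p log q ≤ p log p - p + q by Young's inequality; the last two terms cancel after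
  -- integration because the masses agree.
  have h : ∫ x, (π.rnDeriv ν x).toReal • llr Q ν x ∂ν
      ≤ ∫ x, ((π.rnDeriv ν x).toReal • llr π ν x - (π.rnDeriv ν x).toReal)
        + (Q.rnDeriv ν x).toReal ∂ν := by
    refine integral_mono_ae j2 ((j1.sub k1).add k2) ?_
    filter_upwards [hpos'] with x hx
    have h0 : 0 ≤ (π.rnDeriv ν x).toReal := ENNReal.toReal_nonneg
    by_cases h : π.rnDeriv ν x = 0
    · simp [h]
    · have := mul_le_mul_log_sub_add_exp h0 (llr Q ν x)
      rw [llr, Real.exp_log (hx h)] at this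
      simpa [llr] using this
  have e : ∫ x, (π.rnDeriv ν x).toReal ∂ν = ∫ x, (Q.rnDeriv ν x).toReal ∂ν := by
    rw [Measure.integral_toReal_rnDeriv hπ, Measure.integral_toReal_rnDeriv hQ, Measure.real,
      Measure.real, hmass]
  have j3 : Integrable (fun x => (π.rnDeriv ν x).toReal • llr π ν x - (π.rnDeriv ν x).toReal) ν :=
    j1.sub k1
  rw [integral_add j3 k2, integral_sub j1 k1, e] at h
  linarith

/-- The entropy as a real number, where it is finite. -/
def realEntropy (κ : ℝ) (lam π : Measure α) : ℝ := ∫ x, llr π lam x ∂π - κ * π.real univ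

lemma entropy_eq_coe {κ : ℝ} {lam π : Measure α} (hac : π ≪ lam)
    (hint : Integrable (llr π lam) π) : entropy κ lam π = (realEntropy κ lam π : EReal) := by
  unfold entropy realEntropy
  rw [if_pos ⟨hac, hint⟩]

variable {κ ε : ℝ} {lam : Measure α} {c : α → ℝ} {D : Measure α → ℝ≥0∞} {π : Measure α}

lemma finite_of_regularizedObjective_lt_top (hε : 0 < ε)
    (h : regularizedObjective κ lam ε c D π < ⊤) :
    π ≪ lam ∧ Integrable (llr π lam) π ∧ D π ≠ ∞ := by
  have h1 : π ≪ lam ∧ Integrable (llr π lam) π := by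
    by_contra hn
    refine h.ne (regularizedObjective_eq_top_of_entropy hε ?_)
    unfold entropy
    rw [if_neg hn]
  refine ⟨h1.1, h1.2, fun hD => h.ne ?_⟩
  unfold regularizedObjective
  rw [entropy_eq_coe h1.1 h1.2, hD, ← EReal.coe_mul, ← EReal.coe_add, EReal.coe_ennreal_top,
    EReal.coe_add_top]

lemma regularizedObjective_eq_coe (hac : π ≪ lam) (hint : Integrable (llr π lam) π)
    (hD : D π ≠ ∞) : regularizedObjective κ lam ε c D π
      = ((∫ x, c x ∂π + ε * realEntropy κ lam π + (D π).toReal : ℝ) : EReal) := by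
  unfold regularizedObjective
  rw [entropy_eq_coe hac hint, EReal.coe_add, EReal.coe_add, EReal.coe_mul]
  congr 1
  exact (EReal.coe_ennreal_toReal hD).symm

end Entropy

/-! ### Exact matching, free marginals and weighted penalties -/

section Divergences

variable {α : Type*} [MeasurableSpace α]

lemma isEntropyFunction_indicatorFn_singleton : IsEntropyFunction (indicatorFn {1}) where
  convex x y a b ha hb hab := by
    rcases ha.eq_or_lt with rfl | ha'
    · have : b = 1 := by linarith
      simp [this]
    rcases hb.eq_or_lt with rfl | hb'
    · have : a = 1 := by linarith
      simp [this]
    by_cases hx : x = 1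
    · by_cases hy : y = 1
      · simp [indicatorFn, hx, hy, hab]
      · simp [indicatorFn, hy, ENNReal.mul_top, hb']
    · simp [indicatorFn, hx, ENNReal.mul_top, ha']
  lsc := by
    rw [lowerSemicontinuous_iff_isClosed_preimage]
    intro b
    rcases eq_or_ne b ∞ with rfl | hb
    · have : indicatorFn {1} ⁻¹' Iic ∞ = univ := by ext; simp
      rw [this]; exact isClosed_univ
    · have : indicatorFn {1} ⁻¹' Iic b = {1} := by
        ext x
        by_cases hx : x = 1 <;> simp [indicatorFn, hx, hb]
      rw [this]; exact isClosed_singleton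
  one := by simp [indicatorFn]
  neg x hx := by
    have : x ≠ 1 := by linarith
    simp [indicatorFn, this]

lemma isEntropyFunction_indicatorFn_Ici : IsEntropyFunction (indicatorFn (Ici 0)) where
  convex x y a b ha hb hab := by
    rcases ha.eq_or_lt with rfl | ha'
    · have : b = 1 := by linarith
      simp [this]
    rcases hb.eq_or_lt with rfl | hb'
    · have : a = 1 := by linarith
      simp [this]
    by_cases hx : 0 ≤ x
    · by_cases hy : 0 ≤ y
      · have : 0 ≤ a * x + b * y := by positivity
        simp [indicatorFn, this]
      · simp [indicatorFn, hy, ENNReal.mul_top, hb']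
    · simp [indicatorFn, hx, ENNReal.mul_top, ha']
  lsc := by
    rw [lowerSemicontinuous_iff_isClosed_preimage]
    intro b
    rcases eq_or_ne b ∞ with rfl | hb
    · have : indicatorFn (Ici 0) ⁻¹' Iic ∞ = univ := by ext; simp
      rw [this]; exact isClosed_univ
    · have : indicatorFn (Ici 0) ⁻¹' Iic b = Ici 0 := by
        ext x
        by_cases hx : 0 ≤ x <;> simp [indicatorFn, hx, hb]
      rw [this]; exact isClosed_Ici
  one := by simp [indicatorFn]
  neg x hx := by simp [indicatorFn, hx]

lemma isEntropyFunction_scaleFn {t : ℝ} (ht : 0 < t) {φ : ℝ → ℝ≥0∞} (hφ : IsEntropyFunction φ) :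
    IsEntropyFunction (scaleFn t φ) where
  convex x y a b ha hb hab := by
    unfold scaleFn
    calc _ ≤ ENNReal.ofReal t * (ENNReal.ofReal a * φ x + ENNReal.ofReal b * φ y) := by
          gcongr; exact hφ.convex x y a b ha hb hab
      _ = _ := by ring
  lsc := by
    have hc : Continuous fun s : ℝ≥0∞ => ENNReal.ofReal t * s :=
      ENNReal.continuous_const_mul ENNReal.ofReal_ne_top
    exact hc.comp_lowerSemicontinuous hφ.lsc fun _ _ h => mul_le_mul_right h _
  one := by simp [scaleFn, hφ.one]
  neg x hx := by simp [scaleFn, hφ.neg x hx, ENNReal.mul_top, ht]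

lemma divergence_scaleFn (t : ℝ) {φ : ℝ → ℝ≥0∞} (hφ : IsEntropyFunction φ) (τ μ : Measure α) :
    divergence (scaleFn t φ) τ μ = ENNReal.ofReal t * divergence φ τ μ := by
  have hr : recession (scaleFn t φ) = ENNReal.ofReal t * recession φ := by
    unfold recession scaleFn
    rw [← ENNReal.limsup_const_mul_of_ne_top ENNReal.ofReal_ne_top]
    simp_rw [mul_div_assoc]
  unfold divergence
  rw [hr, mul_add, mul_assoc]
  congr 1
  unfold scaleFn
  exact lintegral_const_mul _ (hφ.measurable.comp (Measure.measurable_rnDeriv _ _).ennreal_toReal)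

lemma divergence_indicatorFn_Ici (τ μ : Measure α) :
    divergence (indicatorFn (Ici 0)) τ μ = 0 := by
  have hr : recession (indicatorFn (Ici 0)) = 0 := by
    unfold recession
    have : (fun x : ℝ => indicatorFn (Ici 0) x / ENNReal.ofReal x) =ᶠ[atTop] fun _ => 0 := by
      filter_upwards [eventually_ge_atTop 0] with x hx
      simp [indicatorFn, hx]
    rw [limsup_congr this, limsup_const]
  unfold divergence
  rw [hr, zero_mul, add_zero]
  simp [indicatorFn]

lemma recession_indicatorFn_singleton : recession (indicatorFn {1}) = ∞ := by
  unfold recession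
  have : (fun x : ℝ => indicatorFn {1} x / ENNReal.ofReal x) =ᶠ[atTop] fun _ => ∞ := by
    filter_upwards [eventually_gt_atTop 1] with x hx
    simp [indicatorFn, hx.ne', ENNReal.top_div]
  rw [limsup_congr this, limsup_const]

lemma divergence_indicatorFn_singleton_self (μ : Measure α) [IsFiniteMeasure μ] :
    divergence (indicatorFn {1}) μ μ = 0 := by
  unfold divergence
  rw [Measure.singularPart_self]
  simp only [Measure.coe_zero, Pi.zero_apply, mul_zero, add_zero]
  rw [lintegral_congr_ae (g := fun _ => 0), lintegral_zero]
  filter_upwards [Measure.rnDeriv_self μ] with x hx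
  simp [hx, indicatorFn]

/-- The recession constant is `∞`, so a finite value excludes a singular part, and it forces the
density to be 1 a.e. -/
lemma eq_of_divergence_indicatorFn_singleton_ne_top {τ μ : Measure α} [IsFiniteMeasure μ]
    [IsFiniteMeasure τ] (h : divergence (indicatorFn {1}) τ μ ≠ ∞) : τ = μ := by
  unfold divergence at h
  rw [ENNReal.add_ne_top, recession_indicatorFn_singleton] at h
  have hs : τ.singularPart μ = 0 := by
    by_contra hs
    exact h.2 (ENNReal.top_mul (by rwa [ne_eq, Measure.measure_univ_eq_zero]))
  have hd : τ.rnDeriv μ =ᵐ[μ] 1 := by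
    have hm : Measurable fun x => indicatorFn {1} (τ.rnDeriv μ x).toReal :=
      isEntropyFunction_indicatorFn_singleton.measurable.comp
        (Measure.measurable_rnDeriv _ _).ennreal_toReal
    filter_upwards [ae_lt_top hm h.1] with x hx
    have : (τ.rnDeriv μ x).toReal = 1 := by
      by_contra h1
      simp [indicatorFn, h1] at hx
    simpa using (ENNReal.toReal_eq_one_iff _).1 this
  rw [← Measure.rnDeriv_add_singularPart τ μ, hs, add_zero, withDensity_congr_ae hd,
    withDensity_one]

end Divergences

/-! ### The tree entropy as the minimal entropy for given edge marginals -/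

section TreeEntropy

variable {N : ℕ} {X : Fin N → Type*} [∀ i, MeasurableSpace (X i)]

/-- The projection of the product measure on two coordinates. -/
lemma exists_pi_map_pair (lam : ∀ i, Measure (X i)) [∀ i, IsFiniteMeasure (lam i)] {i j : Fin N}
    (hij : i ≠ j) : ∃ C : ℝ≥0∞, C ≠ ∞ ∧
      (Measure.pi lam).map (fun x => (x i, x j)) = C • (lam i).prod (lam j) := by
  have hpm : Measurable fun x : ∀ i, X i => (x i, x j) :=
    (measurable_pi_apply i).prodMk (measurable_pi_apply j)
  by_cases hX : ∀ i, Nonempty (X i)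
  swap
  · obtain ⟨k, hk⟩ := not_forall.1 hX
    rw [not_nonempty_iff] at hk
    have : IsEmpty (∀ i, X i) := ⟨fun x => hk.elim (x k)⟩
    refine ⟨0, by simp, ?_⟩
    rw [Measure.eq_zero_of_isEmpty (Measure.pi lam)]
    simp
  · set C : ℝ≥0∞ := (Measure.pi fun k : ({i, j}ᶜ : Finset (Fin N)) => lam k) univ with hC
    refine ⟨C, measure_ne_top _ _, ?_⟩
    ext s hs
    have := lintegral_pi_mul_eq (lam := lam) hij (q := fun _ => 1) measurable_const
      (h := fun _ => C) measurable_const (by ext x; simp [lmarginal, hC])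
      (g := s.indicator 1) (measurable_one.indicator hs)
    rw [Measure.map_apply hpm hs, Measure.smul_apply, smul_eq_mul]
    rw [lintegral_mul_const _ (measurable_one.indicator hs), lintegral_indicator_one hs] at this
    rw [mul_comm, ← this, ← lintegral_indicator_one (hpm hs)]
    refine lintegral_congr fun x => ?_
    rw [mul_one]
    rfl

variable (G : SimpleGraph (Fin N))

/-- Plans on the product with prescribed marginals on nodes and edges. -/
structure HasMarginals (π : Measure (∀ i, X i)) (P : ∀ i, Measure (X i))
    (Pe : ∀ i j, Measure (X i × X j)) : Prop where
  node : ∀ i, π.map (fun x => x i) = P i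
  edge : ∀ i j, i < j → G.Adj i j → π.map (fun x => (x i, x j)) = Pe i j

/-- Nodes and edges carry plans of finite entropy. -/
structure HasFiniteEntropies (lam : ∀ i, Measure (X i)) (P : ∀ i, Measure (X i))
    (Pe : ∀ i j, Measure (X i × X j)) : Prop where
  node_ac : ∀ i, P i ≪ lam i
  node_int : ∀ i, Integrable (llr (P i) (lam i)) (P i)
  edge_ac : ∀ i j, i < j → G.Adj i j → Pe i j ≪ (lam i).prod (lam j)
  edge_int : ∀ i j, i < j → G.Adj i j →
    Integrable (llr (Pe i j) ((lam i).prod (lam j))) (Pe i j)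

/-- The entropy of the Markov plan with given marginals on the edges of a tree. -/
def treeEntropy [DecidableRel G.Adj] (κ : ℝ) (lam : ∀ i, Measure (X i)) (P : ∀ i, Measure (X i))
    (Pe : ∀ i j, Measure (X i × X j)) : ℝ :=
  ∑ i, realEntropy κ (lam i) (P i) + ∑ e ∈ orderedEdges G,
    (realEntropy κ ((lam e.1).prod (lam e.2)) (Pe e.1 e.2)
      - (realEntropy κ (lam e.1) (P e.1) + realEntropy κ (lam e.2) (P e.2)))

variable {G} {lam : ∀ i, Measure (X i)} {P : ∀ i, Measure (X i)}
  {Pe : ∀ i j, Measure (X i × X j)} {π : Measure (∀ i, X i)}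

lemma measurable_pair (i j : Fin N) : Measurable fun x : ∀ i, X i => (x i, x j) :=
  (measurable_pi_apply i).prodMk (measurable_pi_apply j)

lemma HasMarginals.isConsistent (h : HasMarginals G π P Pe) : IsConsistent G P Pe where
  fst i j hlt hij := by
    rw [← h.edge i j hlt hij, ← h.node i, Measure.map_map measurable_fst (measurable_pair i j)]
    rfl
  snd i j hlt hij := by
    rw [← h.edge i j hlt hij, ← h.node j, Measure.map_map measurable_snd (measurable_pair i j)]
    rfl

lemma HasMarginals.mass_node (h : HasMarginals G π P Pe) (i : Fin N) :
    P i univ = π univ := by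
  rw [← h.node i, Measure.map_apply (measurable_pi_apply i) .univ, preimage_univ]

lemma HasMarginals.mass_edge (h : HasMarginals G π P Pe) {i j : Fin N} (hlt : i < j)
    (hij : G.Adj i j) : Pe i j univ = π univ := by
  rw [← h.edge i j hlt hij, Measure.map_apply (measurable_pair i j) .univ, preimage_univ]

/-- The marginals of a plan of finite entropy have finite entropy. -/
lemma hasFiniteEntropies_of_integrable [∀ i, IsFiniteMeasure (lam i)] [IsFiniteMeasure π]
    (h : HasMarginals G π P Pe) (hπ : π ≪ Measure.pi lam)
    (hint : Integrable (llr π (Measure.pi lam)) π) : HasFiniteEntropies G lam P Pe := by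
  have hn : ∀ i, P i ≪ lam i ∧ Integrable (llr (P i) (lam i)) (P i) := by
    intro i
    have := integrable_llr_map (measurable_pi_apply i) (ENNReal.prod_ne_top fun j _ =>
      measure_ne_top (lam j) univ) (Measure.pi_map_eval (μ := lam) i) hπ hint
    simpa only [Function.eval, h.node i] using this
  have he : ∀ i j, i < j → G.Adj i j → Pe i j ≪ (lam i).prod (lam j) ∧
      Integrable (llr (Pe i j) ((lam i).prod (lam j))) (Pe i j) := by
    intro i j hlt hij
    obtain ⟨C, hC, hmap⟩ := exists_pi_map_pair lam hlt.ne
    have := integrable_llr_map (measurable_pair i j) hC hmap hπ hint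
    rwa [h.edge i j hlt hij] at this
  exact ⟨fun i => (hn i).1, fun i => (hn i).2, fun i j h1 h2 => (he i j h1 h2).1,
    fun i j h1 h2 => (he i j h1 h2).2⟩

variable [DecidableRel G.Adj]

/-- The logarithm of the Markov density. -/
lemma ae_log_gluedDensity [∀ i, IsFiniteMeasure (lam i)] [∀ i, IsFiniteMeasure (P i)]
    [∀ i j, IsFiniteMeasure (Pe i j)] (h : HasMarginals G π P Pe)
    (hE : HasFiniteEntropies G lam P Pe) :
    ∀ᵐ x ∂π, 0 < (gluedDensity G lam P Pe x).toReal ∧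
      Real.log (gluedDensity G lam P Pe x).toReal
        = ∑ i, llr (P i) (lam i) (x i) + ∑ e ∈ orderedEdges G,
          (llr (Pe e.1 e.2) ((lam e.1).prod (lam e.2)) (x e.1, x e.2)
            - (llr (P e.1) (lam e.1) (x e.1) + llr (P e.2) (lam e.2) (x e.2))) := by
  have h1 : ∀ᵐ x ∂π, ∀ i, 0 < ((P i).rnDeriv (lam i) (x i)).toReal := by
    rw [ae_all_iff]
    intro i
    have := ae_toReal_rnDeriv_pos (hE.node_ac i)
    rw [← h.node i] at this ⊢
    exact ae_of_ae_map (measurable_pi_apply i).aemeasurable this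
  have h2 : ∀ᵐ x ∂π, ∀ e : Fin N × Fin N, e ∈ orderedEdges G →
      0 < ((Pe e.1 e.2).rnDeriv ((lam e.1).prod (lam e.2)) (x e.1, x e.2)).toReal := by
    rw [ae_all_iff]
    intro e
    by_cases he : e ∈ orderedEdges G
    · obtain ⟨hlt, hij⟩ := (mem_orderedEdges G).1 he
      have := ae_toReal_rnDeriv_pos (hE.edge_ac _ _ hlt hij)
      rw [← h.edge _ _ hlt hij] at this ⊢
      filter_upwards [ae_of_ae_map (measurable_pair e.1 e.2).aemeasurable this] with x hx _
      exact hx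
    · simp [he]
  filter_upwards [h1, h2] with x hx1 hx2
  have e1 : (gluedDensity G lam P Pe x).toReal = (∏ i, ((P i).rnDeriv (lam i) (x i)).toReal) *
      ∏ e ∈ orderedEdges G,
        ((Pe e.1 e.2).rnDeriv ((lam e.1).prod (lam e.2)) (x e.1, x e.2)).toReal *
        ((((P e.1).rnDeriv (lam e.1) (x e.1)).toReal)⁻¹ *
          (((P e.2).rnDeriv (lam e.2) (x e.2)).toReal)⁻¹) := by
    unfold gluedDensity treeDensity
    rw [ENNReal.toReal_mul, ENNReal.toReal_prod, ENNReal.toReal_prod]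
    congr 1
    refine Finset.prod_congr rfl fun e he => ?_
    rw [ENNReal.toReal_mul, ENNReal.toReal_mul, ENNReal.toReal_inv, ENNReal.toReal_inv,
      edgeDensity, if_pos ((mem_orderedEdges G).1 he).1]
  have p1 : 0 < ∏ i, ((P i).rnDeriv (lam i) (x i)).toReal := Finset.prod_pos fun i _ => hx1 i
  have p2 : ∀ e ∈ orderedEdges G,
      0 < ((Pe e.1 e.2).rnDeriv ((lam e.1).prod (lam e.2)) (x e.1, x e.2)).toReal *
        ((((P e.1).rnDeriv (lam e.1) (x e.1)).toReal)⁻¹ *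
          (((P e.2).rnDeriv (lam e.2) (x e.2)).toReal)⁻¹) := fun e he =>
    mul_pos (hx2 e he) (mul_pos (inv_pos.2 (hx1 _)) (inv_pos.2 (hx1 _)))
  rw [e1]
  refine ⟨mul_pos p1 (Finset.prod_pos p2), ?_⟩
  rw [Real.log_mul p1.ne' (Finset.prod_pos p2).ne', Real.log_prod fun i _ => (hx1 i).ne',
    Real.log_prod fun e he => (p2 e he).ne']
  congr 1
  refine Finset.sum_congr rfl fun e he => ?_
  rw [Real.log_mul (hx2 e he).ne' (mul_pos (inv_pos.2 (hx1 _)) (inv_pos.2 (hx1 _))).ne',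
    Real.log_mul (inv_pos.2 (hx1 _)).ne' (inv_pos.2 (hx1 _)).ne', Real.log_inv, Real.log_inv]
  simp only [llr]
  ring

/-- The cross entropy of a plan relative to the Markov density depends only on the marginals. -/
lemma integral_log_gluedDensity [∀ i, IsFiniteMeasure (lam i)] [∀ i, IsFiniteMeasure (P i)]
    [∀ i j, IsFiniteMeasure (Pe i j)] (κ : ℝ) (hG : G.IsTree) (h : HasMarginals G π P Pe)
    (hE : HasFiniteEntropies G lam P Pe) :
    Integrable (fun x => Real.log (gluedDensity G lam P Pe x).toReal) π ∧
      ∫ x, Real.log (gluedDensity G lam P Pe x).toReal ∂π - κ * π.real univ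
        = treeEntropy G κ lam P Pe := by
  have hae := (ae_log_gluedDensity h hE).mono fun x hx => hx.2
  have n1 : ∀ i, Integrable (fun x : ∀ i, X i => llr (P i) (lam i) (x i)) π := by
    intro i
    have := hE.node_int i
    nth_rw 2 [← h.node i] at this
    exact this.comp_measurable (measurable_pi_apply i)
  have n2 : ∀ i, ∫ x, llr (P i) (lam i) (x i) ∂π = ∫ y, llr (P i) (lam i) y ∂P i := by
    intro i
    conv_rhs => rw [← h.node i]
    rw [integral_map (measurable_pi_apply i).aemeasurable
      (measurable_llr _ _).aestronglyMeasurable, h.node i]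
  have m1 : ∀ e ∈ orderedEdges G, Integrable (fun x : ∀ i, X i =>
      llr (Pe e.1 e.2) ((lam e.1).prod (lam e.2)) (x e.1, x e.2)) π := by
    intro e he
    obtain ⟨hlt, hij⟩ := (mem_orderedEdges G).1 he
    have := hE.edge_int _ _ hlt hij
    nth_rw 2 [← h.edge _ _ hlt hij] at this
    exact this.comp_measurable (measurable_pair e.1 e.2)
  have m2 : ∀ e ∈ orderedEdges G,
      ∫ x, llr (Pe e.1 e.2) ((lam e.1).prod (lam e.2)) (x e.1, x e.2) ∂π
        = ∫ y, llr (Pe e.1 e.2) ((lam e.1).prod (lam e.2)) y ∂Pe e.1 e.2 := by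
    intro e he
    obtain ⟨hlt, hij⟩ := (mem_orderedEdges G).1 he
    conv_rhs => rw [← h.edge _ _ hlt hij]
    rw [integral_map (measurable_pair e.1 e.2).aemeasurable
      (measurable_llr _ _).aestronglyMeasurable, h.edge _ _ hlt hij]
  have i1 : Integrable (fun x : ∀ i, X i => ∑ i, llr (P i) (lam i) (x i)) π :=
    integrable_finsetSum _ fun i _ => n1 i
  have i2 : ∀ e ∈ orderedEdges G, Integrable (fun x : ∀ i, X i =>
      llr (Pe e.1 e.2) ((lam e.1).prod (lam e.2)) (x e.1, x e.2)
            - (llr (P e.1) (lam e.1) (x e.1) + llr (P e.2) (lam e.2) (x e.2))) π :=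
    fun e he => (m1 e he).sub ((n1 _).add (n1 _))
  refine ⟨(i1.add (integrable_finsetSum _ i2)).congr (hae.mono fun x hx => hx.symm), ?_⟩
  rw [integral_congr_ae hae, integral_add i1 (integrable_finsetSum _ i2),
    integral_finsetSum _ fun i _ => n1 i, integral_finsetSum _ i2]
  have s2 : ∑ e ∈ orderedEdges G, ∫ x,
      (llr (Pe e.1 e.2) ((lam e.1).prod (lam e.2)) (x e.1, x e.2)
            - (llr (P e.1) (lam e.1) (x e.1) + llr (P e.2) (lam e.2) (x e.2))) ∂π
      = ∑ e ∈ orderedEdges G, ((realEntropy κ ((lam e.1).prod (lam e.2)) (Pe e.1 e.2)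
      - (realEntropy κ (lam e.1) (P e.1) + realEntropy κ (lam e.2) (P e.2)))
        - κ * π.real univ) := by
    refine Finset.sum_congr rfl fun e he => ?_
    obtain ⟨hlt, hij⟩ := (mem_orderedEdges G).1 he
    rw [integral_sub (m1 e he) ((n1 _).fun_add (n1 _)), integral_add (n1 _) (n1 _), m2 e he, n2, n2]
    unfold realEntropy Measure.real
    rw [h.mass_node, h.mass_node, h.mass_edge hlt hij]
    ring
  have s1 : ∑ i, ∫ x, llr (P i) (lam i) (x i) ∂π
      = ∑ i, (realEntropy κ (lam i) (P i) + κ * π.real univ) := by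
    refine Finset.sum_congr rfl fun i _ => ?_
    rw [n2]
    unfold realEntropy Measure.real
    rw [h.mass_node]
    ring
  rw [s1, s2, Finset.sum_add_distrib, Finset.sum_sub_distrib, Finset.sum_const, Finset.sum_const,
    Finset.card_univ, Fintype.card_fin, nsmul_eq_mul, nsmul_eq_mul]
  -- Each node contributes κ times the mass and each edge takes it away once; what remains is the
  -- one term subtracted on the left.
  have hN : (N : ℝ) = (orderedEdges G).card + 1 := by exact_mod_cast (card_orderedEdges hG).symm
  unfold treeEntropy
  rw [hN]
  ring

lemma HasFiniteEntropies.exists_glued [∀ i, IsFiniteMeasure (lam i)] [∀ i, IsFiniteMeasure (P i)]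
    [∀ i j, IsFiniteMeasure (Pe i j)] (hE : HasFiniteEntropies G lam P Pe)
    (h : IsConsistent G P Pe) (hG : G.IsTree) (hdeg : ∀ i, ∃ j, G.Adj i j) :
    ∃ Q : Measure (∀ i, X i), IsFiniteMeasure Q ∧ Q ≪ Measure.pi lam ∧ HasMarginals G Q P Pe ∧
      Q.rnDeriv (Measure.pi lam) =ᵐ[Measure.pi lam] gluedDensity G lam P Pe := by
  obtain ⟨Q, hQ, hac, hedge, hq⟩ := h.exists_glued hG hdeg hE.edge_ac
  refine ⟨Q, hQ, hac, ⟨fun i => ?_, hedge⟩, hq⟩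
  obtain ⟨j, hij⟩ := hdeg i
  rcases lt_or_gt_of_ne hij.ne with hlt | hlt
  · rw [← h.fst i j hlt hij, ← hedge i j hlt hij, Measure.map_map measurable_fst
      (measurable_pair i j)]
    rfl
  · rw [← h.snd j i hlt hij.symm, ← hedge j i hlt hij.symm, Measure.map_map measurable_snd
      (measurable_pair j i)]
    rfl

/-- The Markov plan has the tree entropy. -/
lemma HasFiniteEntropies.exists_glued_entropy_eq [∀ i, IsFiniteMeasure (lam i)]
    [∀ i, IsFiniteMeasure (P i)] [∀ i j, IsFiniteMeasure (Pe i j)] (κ : ℝ)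
    (hE : HasFiniteEntropies G lam P Pe) (h : IsConsistent G P Pe) (hG : G.IsTree)
    (hdeg : ∀ i, ∃ j, G.Adj i j) :
    ∃ Q : Measure (∀ i, X i), IsFiniteMeasure Q ∧ Q ≪ Measure.pi lam ∧ HasMarginals G Q P Pe ∧
      Integrable (llr Q (Measure.pi lam)) Q ∧
      realEntropy κ (Measure.pi lam) Q = treeEntropy G κ lam P Pe := by
  obtain ⟨Q, hQ, hac, hm, hq⟩ := hE.exists_glued h hG hdeg
  obtain ⟨hi, he⟩ := integral_log_gluedDensity κ hG hm hE
  have hae : llr Q (Measure.pi lam) =ᵐ[Q] fun x =>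
      Real.log (gluedDensity G lam P Pe x).toReal := by
    filter_upwards [hac.ae_le hq] with x hx
    rw [llr, hx]
  refine ⟨Q, hQ, hac, hm, hi.congr hae.symm, ?_⟩
  rw [← he, realEntropy, integral_congr_ae hae]

/-- The tree entropy of the marginals is a lower bound of the entropy. -/
lemma HasFiniteEntropies.treeEntropy_le [∀ i, IsFiniteMeasure (lam i)]
    [∀ i, IsFiniteMeasure (P i)] [∀ i j, IsFiniteMeasure (Pe i j)] [IsFiniteMeasure π] (κ : ℝ)
    (hE : HasFiniteEntropies G lam P Pe) (h : HasMarginals G π P Pe) (hG : G.IsTree)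
    (hdeg : ∀ i, ∃ j, G.Adj i j) (hπ : π ≪ Measure.pi lam)
    (hint : Integrable (llr π (Measure.pi lam)) π) :
    treeEntropy G κ lam P Pe ≤ realEntropy κ (Measure.pi lam) π := by
  obtain ⟨Q, hQ, hac, hm, hq⟩ := hE.exists_glued h.isConsistent hG hdeg
  -- The log-density of the Markov plan `Q` is integrated against `π`, not `Q`: as `π` has the same
  -- marginals, the result is again the tree entropy, and Gibbs' inequality compares it with the
  -- entropy of `π`.
  obtain ⟨hi, he⟩ := integral_log_gluedDensity κ hG h hE
  have hae : llr Q (Measure.pi lam) =ᵐ[π] fun x =>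
      Real.log (gluedDensity G lam P Pe x).toReal := by
    filter_upwards [hπ.ae_le hq] with x hx
    rw [llr, hx]
  obtain ⟨i⟩ : Nonempty (Fin N) := hG.connected.nonempty
  have := integral_llr_le_integral_llr hπ hac (by rw [← hm.mass_node i, h.mass_node i]) (by
    filter_upwards [hπ.ae_le hq, ae_log_gluedDensity h hE] with x hx hx'
    rw [hx]; exact hx'.1) hint (hi.congr hae.symm)
  rw [← he, realEntropy, ← integral_congr_ae hae]
  linarith

end TreeEntropy

/-! ### Finite sums of extended reals -/

section EReal

lemma ereal_coe_sum {ι : Type*} (s : Finset ι) (f : ι → ℝ) :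
    ((∑ i ∈ s, f i : ℝ) : EReal) = ∑ i ∈ s, (f i : EReal) := by
  classical
  induction s using Finset.induction_on with
  | empty => simp
  | insert a s ha ih => rw [Finset.sum_insert ha, Finset.sum_insert ha, EReal.coe_add, ih]

lemma ereal_sum_ne_bot {ι : Type*} {s : Finset ι} {f : ι → EReal} (h : ∀ i ∈ s, f i ≠ ⊥) :
    ∑ i ∈ s, f i ≠ ⊥ := by
  classical
  induction s using Finset.induction_on with
  | empty => simp
  | insert a s ha ih =>
    rw [Finset.sum_insert ha, ne_eq, EReal.add_eq_bot_iff, not_or]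
    exact ⟨h a (Finset.mem_insert_self _ _), ih fun i hi => h i (Finset.mem_insert_of_mem hi)⟩

lemma ereal_ne_top_of_sum_ne_top {ι : Type*} {s : Finset ι} {f : ι → EReal}
    (h : ∀ i ∈ s, f i ≠ ⊥) (hs : ∑ i ∈ s, f i ≠ ⊤) {i : ι} (hi : i ∈ s) : f i ≠ ⊤ := by
  classical
  intro ht
  apply hs
  rw [← Finset.add_sum_erase _ _ hi, ht, EReal.top_add_of_ne_bot]
  exact ereal_sum_ne_bot fun j hj => h j (Finset.mem_of_mem_erase hj)

end EReal

/-! ### Both functionals in terms of marginals -/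

section Problem

variable {N : ℕ} {X : Fin N → Type*} [∀ i, MeasurableSpace (X i)]

/-- The penalty at a node. -/
def nodePenalty (V : Finset (Fin N)) (φ : {i // i ∈ V} → ℝ → ℝ≥0∞)
    (μ : ∀ v : {i // i ∈ V}, FiniteMeasure (X v)) (i : Fin N) (τ : Measure (X i)) : ℝ≥0∞ :=
  if h : i ∈ V then divergence (φ ⟨i, h⟩) τ (μ ⟨i, h⟩) else 0

variable {G : SimpleGraph (Fin N)} {lam : ∀ i, Measure (X i)}
  {κ ε M : ℝ} {t : Sym2 (Fin N) → ℝ} {c : ∀ j k, X j × X k → ℝ}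
  {V : Finset (Fin N)} {φ : {i // i ∈ V} → ℝ → ℝ≥0∞}
  {μ : ∀ v : {i // i ∈ V}, FiniteMeasure (X v)}
  {ν : ∀ u : {i // i ∉ V}, FiniteMeasure (X u)}

lemma divergence_exactOff {i : Fin N} {τ : Measure (X i)}
    (h : ∀ hi : i ∉ V, τ = ν ⟨i, hi⟩) :
    divergence (exactOff V φ i) τ (joinMeasures V μ ν i) = nodePenalty V φ μ i τ := by
  by_cases hi : i ∈ V
  · simp [exactOff, joinMeasures, nodePenalty, hi]
  · rw [h hi]
    simp [exactOff, joinMeasures, nodePenalty, hi, divergence_indicatorFn_singleton_self]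

lemma eq_of_divergence_exactOff_ne_top {i : Fin N} {τ : Measure (X i)} [IsFiniteMeasure τ]
    (h : divergence (exactOff V φ i) τ (joinMeasures V μ ν i) ≠ ∞) (hi : i ∉ V) :
    τ = ν ⟨i, hi⟩ := by
  simp only [exactOff, joinMeasures, hi, dif_neg, not_false_iff] at h
  exact eq_of_divergence_indicatorFn_singleton_ne_top h

/-- At free nodes both sides are 0, so the weight there is immaterial and the penalties can be
summed over all nodes with one formula. -/
lemma divergence_freeOff [DecidableRel G.Adj] (hφ : ∀ v, IsEntropyFunction (φ v)) {i : Fin N}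
    (τ : Measure (X i)) :
    divergence (freeOff G t V φ i) τ (joinMeasures V μ ν i)
      = ENNReal.ofReal (leafWeight G t i) * nodePenalty V φ μ i τ := by
  by_cases hi : i ∈ V
  · simp [freeOff, joinMeasures, nodePenalty, hi, divergence_scaleFn _ (hφ _)]
  · simp [freeOff, joinMeasures, nodePenalty, hi, divergence_indicatorFn_Ici]

lemma isEntropyFunction_exactOff (hφ : ∀ v, IsEntropyFunction (φ v)) (i : Fin N) :
    IsEntropyFunction (exactOff V φ i) := by
  unfold exactOff
  split_ifs with h
  · exact hφ _
  · exact isEntropyFunction_indicatorFn_singleton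

lemma isEntropyFunction_freeOff [DecidableRel G.Adj] (hφ : ∀ v, IsEntropyFunction (φ v))
    (ht : ∀ i, 0 < leafWeight G t i) (i : Fin N) : IsEntropyFunction (freeOff G t V φ i) := by
  unfold freeOff
  split_ifs with h
  · exact isEntropyFunction_scaleFn (ht i) (hφ _)
  · exact isEntropyFunction_indicatorFn_Ici

/-- The two-marginal penalty of an edge problem. -/
def edgePenalty (V : Finset (Fin N)) (φ : {i // i ∈ V} → ℝ → ℝ≥0∞)
    (μ : ∀ v : {i // i ∈ V}, FiniteMeasure (X v)) (ν : ∀ u : {i // i ∉ V}, FiniteMeasure (X u))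
    (j k : Fin N) (π : Measure (X j × X k)) : ℝ≥0∞ :=
  divergence (exactOff V φ j) (π.map Prod.fst) (joinMeasures V μ ν j)
    + divergence (exactOff V φ k) (π.map Prod.snd) (joinMeasures V μ ν k)

lemma isConvexPenalty_edgePenalty (hφ : ∀ v, IsEntropyFunction (φ v)) (j k : Fin N)
    {lam : Measure (X j × X k)} : IsConvexPenalty lam (edgePenalty V φ μ ν j k) :=
  (isConvexPenalty_divergence_map (isEntropyFunction_exactOff hφ j) measurable_fst _).add
    (isConvexPenalty_divergence_map (isEntropyFunction_exactOff hφ k) measurable_snd _)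

/-- The penalty of the multi-marginal problem. -/
def multiPenalty (G : SimpleGraph (Fin N)) [DecidableRel G.Adj] (t : Sym2 (Fin N) → ℝ)
    (V : Finset (Fin N)) (φ : {i // i ∈ V} → ℝ → ℝ≥0∞)
    (μ : ∀ v : {i // i ∈ V}, FiniteMeasure (X v)) (ν : ∀ u : {i // i ∉ V}, FiniteMeasure (X u))
    (π : Measure (∀ i, X i)) : ℝ≥0∞ :=
  ∑ i, divergence (freeOff G t V φ i) (π.map fun x => x i) (joinMeasures V μ ν i)

variable [DecidableRel G.Adj]

lemma isConvexPenalty_multiPenalty (hφ : ∀ v, IsEntropyFunction (φ v))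
    (ht : ∀ i, 0 < leafWeight G t i) {lam : Measure (∀ i, X i)} :
    IsConvexPenalty lam (multiPenalty G t V φ μ ν) :=
  IsConvexPenalty.sum Finset.univ fun i =>
    isConvexPenalty_divergence_map (isEntropyFunction_freeOff hφ ht i) (measurable_pi_apply i) _

/-- The common value of the two functionals at a consistent family of plans, as a real number. -/
def consistentValue (G : SimpleGraph (Fin N)) [DecidableRel G.Adj] (κ : ℝ)
    (lam : ∀ i, Measure (X i)) (ε : ℝ) (t : Sym2 (Fin N) → ℝ) (c : ∀ j k, X j × X k → ℝ)
    (V : Finset (Fin N)) (φ : {i // i ∈ V} → ℝ → ℝ≥0∞)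
    (μ : ∀ v : {i // i ∈ V}, FiniteMeasure (X v)) (P : ∀ i, Measure (X i))
    (Pe : ∀ i j, Measure (X i × X j)) : ℝ :=
  ∑ e ∈ orderedEdges G, t s(e.1, e.2) * ∫ z, c e.1 e.2 z ∂Pe e.1 e.2
    + ε * treeEntropy G κ lam P Pe
    + ∑ i, leafWeight G t i * (nodePenalty V φ μ i (P i)).toReal

/-- The value of an edge problem at a plan, as a real number. -/
def edgeValue (κ : ℝ) (lam : ∀ i, Measure (X i)) (ε : ℝ) (t : Sym2 (Fin N) → ℝ)
    (c : ∀ j k, X j × X k → ℝ) (V : Finset (Fin N)) (φ : {i // i ∈ V} → ℝ → ℝ≥0∞)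
    (μ : ∀ v : {i // i ∈ V}, FiniteMeasure (X v)) (P : ∀ i, Measure (X i))
    (Pe : ∀ i j, Measure (X i × X j)) (e : Fin N × Fin N) : ℝ :=
  ∫ z, c e.1 e.2 z ∂Pe e.1 e.2
    + ε / t s(e.1, e.2) * realEntropy κ ((lam e.1).prod (lam e.2)) (Pe e.1 e.2)
    + ((nodePenalty V φ μ e.1 (P e.1)).toReal + (nodePenalty V φ μ e.2 (P e.2)).toReal)

variable {P : ∀ i, Measure (X i)} {Pe : ∀ i j, Measure (X i × X j)}

/-- The sum of the edge values, corrected by the entropies of the inner nodes. -/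
lemma sum_edgeValue_sub (ht : ∀ e ∈ G.edgeFinset, 0 < t e) (hV : ∀ v ∈ V, G.degree v = 1) :
    ∑ e ∈ orderedEdges G, t s(e.1, e.2) * edgeValue κ lam ε t c V φ μ P Pe e
      - ε * ∑ u : {i // i ∉ V}, ((G.degree u : ℝ) - 1) * realEntropy κ (lam u) (P u)
      = consistentValue G κ lam ε t c V φ μ P Pe := by
  have h1 : ∀ e ∈ orderedEdges G, t s(e.1, e.2) * edgeValue κ lam ε t c V φ μ P Pe e
      = t s(e.1, e.2) * ∫ z, c e.1 e.2 z ∂Pe e.1 e.2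
        + ε * realEntropy κ ((lam e.1).prod (lam e.2)) (Pe e.1 e.2)
        + t s(e.1, e.2) * ((nodePenalty V φ μ e.1 (P e.1)).toReal
          + (nodePenalty V φ μ e.2 (P e.2)).toReal) := by
    intro e he
    have : 0 < t s(e.1, e.2) := ht _ (by simpa using ((mem_orderedEdges G).1 he).2)
    unfold edgeValue
    field_simp
  rw [Finset.sum_congr rfl h1, Finset.sum_add_distrib, Finset.sum_add_distrib,
    sum_orderedEdges_ends G t fun i => (nodePenalty V φ μ i (P i)).toReal]
  -- Nodes of `V` have degree 1 and coefficient 0, so the correction extends to all nodes; the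
  -- handshake identity then turns it into the node terms of the tree entropy.
  have h2 : ∑ u : {i // i ∉ V}, ((G.degree u : ℝ) - 1) * realEntropy κ (lam u) (P u)
      = ∑ i, ((G.degree i : ℝ) - 1) * realEntropy κ (lam i) (P i) := by
    rw [← Finset.sum_subtype (Finset.univ.filter fun i => i ∉ V) (by simp)
      fun i => ((G.degree i : ℝ) - 1) * realEntropy κ (lam i) (P i)]
    refine Finset.sum_filter_of_ne fun i _ hi hiV => hi ?_
    rw [hV i hiV, Nat.cast_one, sub_self, zero_mul]
  have h3 := sum_orderedEdges_ends_eq_degree G fun i => realEntropy κ (lam i) (P i)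
  have h4 : ∑ i, ((G.degree i : ℝ) - 1) * realEntropy κ (lam i) (P i)
      = ∑ e ∈ orderedEdges G, (realEntropy κ (lam e.1) (P e.1) + realEntropy κ (lam e.2) (P e.2))
        - ∑ i, realEntropy κ (lam i) (P i) := by
    rw [h3, ← Finset.sum_sub_distrib]
    exact Finset.sum_congr rfl fun i _ => by ring
  rw [h2, h4]
  unfold consistentValue treeEntropy leafWeight
  rw [Finset.sum_sub_distrib, ← Finset.mul_sum]
  simp_rw [mul_comm (∑ e ∈ G.incidenceFinset _, t e)]
  ring

/-- Edge plans with the right marginals have the edge value as their value. -/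
lemma uotObjective_eq_edgeValue (h : IsConsistent G P Pe) (hE : HasFiniteEntropies G lam P Pe)
    (hν : ∀ (i) (hi : i ∉ V), P i = ν ⟨i, hi⟩) (hfin : ∀ i, nodePenalty V φ μ i (P i) ≠ ∞)
    {e : Fin N × Fin N} (he : e ∈ orderedEdges G) :
    regularizedObjective κ ((lam e.1).prod (lam e.2)) (ε / t s(e.1, e.2)) (c e.1 e.2)
        (edgePenalty V φ μ ν e.1 e.2) (Pe e.1 e.2)
      = (edgeValue κ lam ε t c V φ μ P Pe e : EReal) := by
  obtain ⟨hlt, hij⟩ := (mem_orderedEdges G).1 he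
  have hp : edgePenalty V φ μ ν e.1 e.2 (Pe e.1 e.2)
      = nodePenalty V φ μ e.1 (P e.1) + nodePenalty V φ μ e.2 (P e.2) := by
    unfold edgePenalty
    rw [h.fst _ _ hlt hij, h.snd _ _ hlt hij, divergence_exactOff (hν _),
      divergence_exactOff (hν _)]
  rw [regularizedObjective_eq_coe (hE.edge_ac _ _ hlt hij) (hE.edge_int _ _ hlt hij)
    (by rw [hp]; exact ENNReal.add_ne_top.2 ⟨hfin _, hfin _⟩), hp,
    ENNReal.toReal_add (hfin _) (hfin _)]
  rfl

lemma integral_treeCost (hcm : ∀ j k, Measurable (c j k)) (hcM : ∀ j k z, |c j k z| ≤ M)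
    {π : Measure (∀ i, X i)} [IsFiniteMeasure π] (h : HasMarginals G π P Pe) :
    ∫ x, treeCost G t c x ∂π
      = ∑ e ∈ orderedEdges G, t s(e.1, e.2) * ∫ z, c e.1 e.2 z ∂Pe e.1 e.2 := by
  have hi : ∀ j k, Integrable (fun x : ∀ i, X i => c j k (x j, x k)) π := fun j k =>
    Integrable.of_bound ((hcm j k).comp (measurable_pair j k)).aestronglyMeasurable M
      (Eventually.of_forall fun x => hcM j k _)
  unfold treeCost
  rw [integral_finsetSum _ fun e _ => (hi _ _).const_mul _]
  refine Finset.sum_congr rfl fun e he => ?_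
  obtain ⟨hlt, hij⟩ := (mem_orderedEdges G).1 he
  rw [integral_const_mul, ← h.edge _ _ hlt hij,
    integral_map (measurable_pair _ _).aemeasurable (hcm _ _).aestronglyMeasurable]

lemma multiPenalty_eq (hφ : ∀ v, IsEntropyFunction (φ v)) {π : Measure (∀ i, X i)}
    (h : HasMarginals G π P Pe) : multiPenalty G t V φ μ ν π
      = ∑ i, ENNReal.ofReal (leafWeight G t i) * nodePenalty V φ μ i (P i) := by
  unfold multiPenalty
  refine Finset.sum_congr rfl fun i _ => ?_
  rw [divergence_freeOff hφ, h.node i]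

/-- The value of the multi-marginal problem, in terms of the marginals and the entropy. -/
lemma multiObjective_eq (hφ : ∀ v, IsEntropyFunction (φ v)) (ht : ∀ i, 0 < leafWeight G t i)
    (hcm : ∀ j k, Measurable (c j k)) (hcM : ∀ j k z, |c j k z| ≤ M)
    {π : Measure (∀ i, X i)} [IsFiniteMeasure π] (h : HasMarginals G π P Pe)
    (hac : π ≪ Measure.pi lam) (hint : Integrable (llr π (Measure.pi lam)) π)
    (hfin : ∀ i, nodePenalty V φ μ i (P i) ≠ ∞) :
    regularizedObjective κ (Measure.pi lam) ε (treeCost G t c) (multiPenalty G t V φ μ ν) π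
      = ((consistentValue G κ lam ε t c V φ μ P Pe
        + ε * (realEntropy κ (Measure.pi lam) π - treeEntropy G κ lam P Pe) : ℝ) : EReal) := by
  have hne : ∀ i, ENNReal.ofReal (leafWeight G t i) * nodePenalty V φ μ i (P i) ≠ ∞ := fun i =>
    ENNReal.mul_ne_top ENNReal.ofReal_ne_top (hfin i)
  have hp : (multiPenalty G t V φ μ ν π).toReal
      = ∑ i, leafWeight G t i * (nodePenalty V φ μ i (P i)).toReal := by
    rw [multiPenalty_eq hφ h, ENNReal.toReal_sum fun i _ => hne i]
    refine Finset.sum_congr rfl fun i _ => ?_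
    rw [ENNReal.toReal_mul, ENNReal.toReal_ofReal (ht i).le]
  rw [regularizedObjective_eq_coe hac hint
    (by rw [multiPenalty_eq hφ h]; exact ENNReal.sum_ne_top.2 fun i _ => hne i), hp,
    integral_treeCost hcm hcM h]
  unfold consistentValue
  congr 1
  ring

/-- The functional of the measures at the inner nodes, when the edge values are finite. -/
lemma innerObjective_eq_coe {r : ℝ}
    (hsum : edgeSum G κ lam ε t c (exactOff V φ) (joinMeasures V μ ν) = (r : EReal))
    (hE : ∀ u : {i // i ∉ V}, (ν u : Measure (X u)) ≪ lam u ∧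
      Integrable (llr (ν u : Measure (X u)) (lam u)) (ν u : Measure (X u))) :
    innerObjective G κ lam ε t c V φ μ ν
      = ((r - ε * ∑ u : {i // i ∉ V}, ((G.degree u : ℝ) - 1) *
          realEntropy κ (lam u) (ν u : Measure (X u)) : ℝ) : EReal) := by
  unfold innerObjective
  rw [hsum, if_neg (EReal.coe_ne_top r), EReal.coe_sub, EReal.coe_mul, ereal_coe_sum]
  congr 2
  refine Finset.sum_congr rfl fun u _ => ?_
  rw [entropy_eq_coe (hE u).1 (hE u).2, EReal.coe_mul]

end Problem

/-! ### Passing between multi-marginal plans and inner measures -/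

section Equality

variable {N : ℕ} {X : Fin N → Type*} [∀ i, MeasurableSpace (X i)]
  {G : SimpleGraph (Fin N)} [DecidableRel G.Adj] {lam : ∀ i, Measure (X i)}
  [∀ i, IsFiniteMeasure (lam i)]
  {κ ε M : ℝ} {t : Sym2 (Fin N) → ℝ} {c : ∀ j k, X j × X k → ℝ}
  {V : Finset (Fin N)} {φ : {i // i ∈ V} → ℝ → ℝ≥0∞}
  {μ : ∀ v : {i // i ∈ V}, FiniteMeasure (X v)}

lemma edge_weight_pos (ht : ∀ e ∈ G.edgeFinset, 0 < t e) {e : Fin N × Fin N}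
    (he : e ∈ orderedEdges G) : 0 < t s(e.1, e.2) :=
  ht _ (by simpa using ((mem_orderedEdges G).1 he).2)

lemma leafWeight_pos (ht : ∀ e ∈ G.edgeFinset, 0 < t e) (hdeg : ∀ i, ∃ j, G.Adj i j)
    (i : Fin N) : 0 < leafWeight G t i := by
  obtain ⟨j, hij⟩ := hdeg i
  refine Finset.sum_pos (fun e he => ht e ?_) ⟨s(i, j), by simpa using hij⟩
  rw [SimpleGraph.mem_incidenceFinset] at he
  exact SimpleGraph.mem_edgeFinset.2 he.1

/-- Weights that sum to 1 exclude the tree with a single node and no edge. -/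
lemma exists_adj_of_sum_eq_one (hG : G.IsTree) (ht_sum : ∑ e ∈ G.edgeFinset, t e = 1)
    (i : Fin N) : ∃ j, G.Adj i j := by
  obtain ⟨e, he⟩ : G.edgeFinset.Nonempty := by
    by_contra h
    rw [Finset.not_nonempty_iff_eq_empty] at h
    simp [h] at ht_sum
  have : Nontrivial (Fin N) := by
    induction e using Sym2.ind with
    | _ a b =>
      have hab : G.Adj a b := by simpa using he
      exact ⟨a, b, hab.ne⟩
  exact (G.degree_pos_iff_exists_adj i).1 (hG.connected.preconnected.degree_pos_of_nontrivial i)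

/-- A plan of the multi-marginal problem yields measures at the inner nodes that are at least as
good. -/
lemma innerObjective_le_of_marginals (hε : 0 < ε) (hG : G.IsTree)
    (ht : ∀ e ∈ G.edgeFinset, 0 < t e) (hdeg : ∀ i, ∃ j, G.Adj i j)
    (hV : ∀ v ∈ V, G.degree v = 1) (hφ : ∀ v, IsEntropyFunction (φ v))
    (hcm : ∀ j k, Measurable (c j k)) (hcM : ∀ j k z, |c j k z| ≤ M)
    {ν₀ ν : ∀ u : {i // i ∉ V}, FiniteMeasure (X u)} (π : FiniteMeasure (∀ i, X i))
    (hν : ∀ u : {i // i ∉ V},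
      (ν u : Measure (X u)) = (π : Measure (∀ i, X i)).map fun x => x u) :
    innerObjective G κ lam ε t c V φ μ ν
      ≤ regularizedObjective κ (Measure.pi lam) ε (treeCost G t c) (multiPenalty G t V φ μ ν₀)
        π := by
  have hlw := leafWeight_pos ht hdeg
  rcases eq_or_ne (regularizedObjective κ (Measure.pi lam) ε (treeCost G t c)
    (multiPenalty G t V φ μ ν₀) π) ⊤ with htop | htop
  · rw [htop]; exact le_top
  obtain ⟨hac, hint, hpen⟩ := finite_of_regularizedObjective_lt_top hε htop.lt_top
  set P : ∀ i, Measure (X i) := fun i => (π : Measure (∀ i, X i)).map fun x => x i with hP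
  set Pe : ∀ i j, Measure (X i × X j) := fun i j =>
    (π : Measure (∀ i, X i)).map fun x => (x i, x j) with hPe
  have hm : HasMarginals G (π : Measure (∀ i, X i)) P Pe := ⟨fun _ => rfl, fun _ _ _ _ => rfl⟩
  have hE : HasFiniteEntropies G lam P Pe := hasFiniteEntropies_of_integrable hm hac hint
  have hfin : ∀ i, nodePenalty V φ μ i (P i) ≠ ∞ := by
    intro i hi
    rw [multiPenalty_eq hφ hm, ENNReal.sum_ne_top] at hpen
    refine hpen i (Finset.mem_univ i) ?_
    rw [hi, ENNReal.mul_top (by simpa using hlw i)]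
  have hνP : ∀ (i) (hi : i ∉ V), P i = ν ⟨i, hi⟩ := fun i hi => (hν ⟨i, hi⟩).symm
  -- The edge marginals of `π` are admissible in the edge problems, which bounds the infima from
  -- above.
  have hle : edgeSum G κ lam ε t c (exactOff V φ) (joinMeasures V μ ν)
      ≤ ((∑ e ∈ orderedEdges G, t s(e.1, e.2) * edgeValue κ lam ε t c V φ μ P Pe e : ℝ) :
        EReal) := by
    rw [ereal_coe_sum]
    refine Finset.sum_le_sum fun e he => ?_
    rw [EReal.coe_mul]
    refine mul_le_mul_of_nonneg_left ?_ (EReal.coe_nonneg.2 (edge_weight_pos ht he).le)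
    rw [← uotObjective_eq_edgeValue hm.isConsistent hE hνP hfin he]
    exact iInf_le (fun p : FiniteMeasure (X e.1 × X e.2) => uotObjective κ (lam e.1) (lam e.2)
      (ε / t s(e.1, e.2)) (c e.1 e.2) (exactOff V φ e.1) (exactOff V φ e.2)
      (joinMeasures V μ ν e.1) (joinMeasures V μ ν e.2) p) ⟨Pe e.1 e.2, inferInstance⟩
  rw [multiObjective_eq hφ hlw hcm hcM hm hac hint hfin]
  have hb := hE.treeEntropy_le κ hm hG hdeg hac hint
  have hS : ∑ u : {i // i ∉ V}, (((G.degree u : ℝ) - 1 : ℝ) : EReal) *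
        entropy κ (lam u) (ν u : Measure (X u))
      = ((∑ u : {i // i ∉ V}, ((G.degree u : ℝ) - 1) * realEntropy κ (lam u) (P u) : ℝ) :
        EReal) := by
    rw [ereal_coe_sum]
    refine Finset.sum_congr rfl fun u _ => ?_
    rw [hν u, entropy_eq_coe (hE.node_ac u) (hE.node_int u), EReal.coe_mul]
  unfold innerObjective
  rw [if_neg (ne_top_of_le_ne_top (EReal.coe_ne_top _) hle), hS, ← EReal.coe_mul]
  refine (EReal.sub_le_sub hle le_rfl).trans ?_
  rw [← EReal.coe_sub, EReal.coe_le_coe_iff, sum_edgeValue_sub ht hV]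
  have := mul_nonneg hε.le (sub_nonneg.2 hb)
  linarith

/-- Measures at the inner nodes with finite value are the marginals of a plan of the multi-marginal
problem with the same value. -/
lemma exists_multi_of_innerObjective_ne_top (hε : 0 < ε) (hG : G.IsTree)
    (ht : ∀ e ∈ G.edgeFinset, 0 < t e) (hdeg : ∀ i, ∃ j, G.Adj i j)
    (hV : ∀ v ∈ V, G.degree v = 1) (hφ : ∀ v, IsEntropyFunction (φ v))
    (hcm : ∀ j k, Measurable (c j k)) (hcM : ∀ j k z, |c j k z| ≤ M)
    {ν₀ ν : ∀ u : {i // i ∉ V}, FiniteMeasure (X u)}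
    (hfinite : innerObjective G κ lam ε t c V φ μ ν ≠ ⊤) :
    ∃ Q : FiniteMeasure (∀ i, X i),
      regularizedObjective κ (Measure.pi lam) ε (treeCost G t c) (multiPenalty G t V φ μ ν₀) Q
        = innerObjective G κ lam ε t c V φ μ ν ∧
      ∀ u : {i // i ∉ V}, (ν u : Measure (X u)) = (Q : Measure (∀ i, X i)).map fun x => x u := by
  have hlw := leafWeight_pos ht hdeg
  have hpos := fun e he => edge_weight_pos (e := e) ht he
  have hsum : edgeSum G κ lam ε t c (exactOff V φ) (joinMeasures V μ ν) ≠ ⊤ := by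
    intro h
    unfold innerObjective at hfinite
    exact hfinite (if_pos h)
  let val : Fin N × Fin N → EReal := fun e => UOT κ (lam e.1) (lam e.2) (ε / t s(e.1, e.2))
    (c e.1 e.2) (exactOff V φ e.1) (exactOff V φ e.2) (joinMeasures V μ ν e.1)
    (joinMeasures V μ ν e.2)
  have hmin : ∀ e ∈ orderedEdges G, val e < ⊤ → ∃ p : FiniteMeasure (X e.1 × X e.2),
      val e = regularizedObjective κ ((lam e.1).prod (lam e.2)) (ε / t s(e.1, e.2)) (c e.1 e.2)
        (edgePenalty V φ μ ν e.1 e.2) p := by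
    intro e he hlt
    obtain ⟨p, hp, -⟩ := existsUnique_regularizedObjective (div_pos hε (hpos e he))
      (hcm e.1 e.2) (hcM e.1 e.2) (isConvexPenalty_edgePenalty (μ := μ) (ν := ν) hφ e.1 e.2) hlt
    exact ⟨p, hp⟩
  have hbot : ∀ e ∈ orderedEdges G, (t s(e.1, e.2) : EReal) * val e ≠ ⊥ := by
    intro e he
    rcases eq_or_ne (val e) ⊤ with h | h
    · rw [h, EReal.coe_mul_top_of_pos (hpos e he)]; exact top_ne_bot
    · obtain ⟨p, hp⟩ := hmin e he h.lt_top
      have hb := regularizedObjective_ne_bot (κ := κ) (lam := (lam e.1).prod (lam e.2))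
        (c := c e.1 e.2) (D := edgePenalty V φ μ ν e.1 e.2) (div_pos hε (hpos e he))
        (p : Measure (X e.1 × X e.2))
      rw [← hp] at hb
      lift val e to ℝ using ⟨h, hb⟩ with r
      rw [← EReal.coe_mul]
      exact EReal.coe_ne_bot _
  have hlt : ∀ e ∈ orderedEdges G, val e < ⊤ := by
    intro e he
    have := ereal_ne_top_of_sum_ne_top hbot hsum he
    refine lt_top_iff_ne_top.2 fun h => this ?_
    rw [h, EReal.coe_mul_top_of_pos (hpos e he)]
  -- Optimal edge plans, with the zero plan as a default value for pairs that are not ordered edges.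
  -- Near-optimal plans would only give an inequality of values.
  have hex : ∀ j k, ∃ p : FiniteMeasure (X j × X k), j < k → G.Adj j k →
      val (j, k) = regularizedObjective κ ((lam j).prod (lam k)) (ε / t s(j, k)) (c j k)
        (edgePenalty V φ μ ν j k) p := by
    intro j k
    by_cases h : j < k ∧ G.Adj j k
    · obtain ⟨p, hp⟩ := hmin (j, k) ((mem_orderedEdges G).2 h) (hlt _ ((mem_orderedEdges G).2 h))
      exact ⟨p, fun _ _ => hp⟩
    · exact ⟨0, fun h1 h2 => absurd ⟨h1, h2⟩ h⟩
  choose Pe hPe using hex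
  have hEdge : ∀ j k, j < k → G.Adj j k → (Pe j k : Measure (X j × X k)) ≪ (lam j).prod (lam k) ∧
      Integrable (llr (Pe j k : Measure (X j × X k)) ((lam j).prod (lam k)))
        (Pe j k : Measure (X j × X k)) ∧
      edgePenalty V φ μ ν j k (Pe j k) ≠ ∞ := by
    intro j k h1 h2
    have he := (mem_orderedEdges G).2 (show (j, k).1 < (j, k).2 ∧ G.Adj (j, k).1 (j, k).2 from
      ⟨h1, h2⟩)
    refine finite_of_regularizedObjective_lt_top (κ := κ) (c := c j k)
      (div_pos hε (hpos (j, k) he)) ?_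
    rw [← hPe j k h1 h2]
    exact hlt _ he
  -- Consistency: outside `V`, finite exact-matching penalties force the marginal to be `ν`; a node
  -- of `V` has a single edge, whose plan defines the marginal.
  have hnode : ∀ i, ∃ p : FiniteMeasure (X i), (∀ hi : i ∉ V, p = ν ⟨i, hi⟩) ∧
      (∀ j, i < j → G.Adj i j → (Pe i j : Measure (X i × X j)).map Prod.fst = p) ∧
      (∀ j, j < i → G.Adj j i → (Pe j i : Measure (X j × X i)).map Prod.snd = p) := by
    intro i
    by_cases hi : i ∈ V
    · obtain ⟨j, hj, huniq⟩ := SimpleGraph.degree_eq_one_iff_existsUnique_adj.1 (hV i hi)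
      rcases lt_or_gt_of_ne hj.ne with hlt | hlt
      · refine ⟨⟨(Pe i j : Measure (X i × X j)).map Prod.fst, inferInstance⟩,
          fun h => absurd hi h, fun k _ hik => ?_, fun k hk hik => ?_⟩
        · obtain rfl := huniq k hik
          rfl
        · obtain rfl := huniq k hik.symm
          exact absurd hlt hk.asymm
      · refine ⟨⟨(Pe j i : Measure (X j × X i)).map Prod.snd, inferInstance⟩,
          fun h => absurd hi h, fun k hk hik => ?_, fun k _ hik => ?_⟩
        · obtain rfl := huniq k hik
          exact absurd hlt hk.asymm
        · obtain rfl := huniq k hik.symm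
          rfl
    · refine ⟨ν ⟨i, hi⟩, fun _ => rfl, fun j h1 h2 => ?_, fun j h1 h2 => ?_⟩
      · have := (ENNReal.add_ne_top.1 (hEdge i j h1 h2).2.2).1
        exact eq_of_divergence_exactOff_ne_top this hi
      · have := (ENNReal.add_ne_top.1 (hEdge j i h1 h2).2.2).2
        exact eq_of_divergence_exactOff_ne_top this hi
  choose P hPν hPfst hPsnd using hnode
  let P' : ∀ i, Measure (X i) := fun i => P i
  let Pe' : ∀ i j, Measure (X i × X j) := fun i j => Pe i j
  have hcons : IsConsistent G P' Pe' :=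
    ⟨fun i j h1 h2 => hPfst i j h1 h2, fun i j h1 h2 => hPsnd j i h1 h2⟩
  have hnodeE : ∀ i, P' i ≪ lam i ∧ Integrable (llr (P' i) (lam i)) (P' i) := by
    intro i
    obtain ⟨j, hij⟩ := hdeg i
    rcases lt_or_gt_of_ne hij.ne with h1 | h1
    · have := integrable_llr_map measurable_fst (measure_ne_top (lam j) univ)
        Measure.map_fst_prod (hEdge i j h1 hij).1 (hEdge i j h1 hij).2.1
      rwa [hPfst i j h1 hij] at this
    · have := integrable_llr_map measurable_snd (measure_ne_top (lam j) univ)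
        Measure.map_snd_prod (hEdge j i h1 hij.symm).1 (hEdge j i h1 hij.symm).2.1
      rwa [hPsnd i j h1 hij.symm] at this
  have hE : HasFiniteEntropies G lam P' Pe' :=
    ⟨fun i => (hnodeE i).1, fun i => (hnodeE i).2, fun i j h1 h2 => (hEdge i j h1 h2).1,
      fun i j h1 h2 => (hEdge i j h1 h2).2.1⟩
  have hνP : ∀ (i) (hi : i ∉ V), P' i = ν ⟨i, hi⟩ := fun i hi =>
    congrArg (fun p : FiniteMeasure (X i) => (p : Measure (X i))) (hPν i hi)
  have hfin : ∀ i, nodePenalty V φ μ i (P' i) ≠ ∞ := by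
    intro i
    rw [← divergence_exactOff (hνP i)]
    obtain ⟨j, hij⟩ := hdeg i
    rcases lt_or_gt_of_ne hij.ne with h1 | h1
    · have := (ENNReal.add_ne_top.1 (hEdge i j h1 hij).2.2).1
      rwa [hPfst i j h1 hij] at this
    · have := (ENNReal.add_ne_top.1 (hEdge j i h1 hij.symm).2.2).2
      rwa [hPsnd i j h1 hij.symm] at this
  have hvals : edgeSum G κ lam ε t c (exactOff V φ) (joinMeasures V μ ν)
      = ((∑ e ∈ orderedEdges G, t s(e.1, e.2) * edgeValue κ lam ε t c V φ μ P' Pe' e : ℝ) :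
        EReal) := by
    rw [ereal_coe_sum]
    refine Finset.sum_congr rfl fun e he => ?_
    obtain ⟨h1, h2⟩ := (mem_orderedEdges G).1 he
    rw [EReal.coe_mul, ← uotObjective_eq_edgeValue hcons hE hνP hfin he]
    exact congrArg _ (hPe e.1 e.2 h1 h2)
  -- The Markov plan has no entropy excess over the tree entropy, so its value is exactly that of
  -- the edge plans.
  obtain ⟨Q, hQ, hac, hm, hint, hent⟩ := hE.exists_glued_entropy_eq κ hcons hG hdeg
  refine ⟨⟨Q, hQ⟩, ?_, fun u => ?_⟩
  · rw [innerObjective_eq_coe hvals fun u => by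
      rw [← hνP u u.2]; exact hnodeE u]
    change regularizedObjective κ (Measure.pi lam) ε (treeCost G t c)
      (multiPenalty G t V φ μ ν₀) Q = _
    rw [multiObjective_eq hφ hlw hcm hcM hm hac hint hfin, hent, sub_self, mul_zero, add_zero,
      ← sum_edgeValue_sub ht hV]
    congr 3
    refine Finset.sum_congr rfl fun u _ => ?_
    rw [hνP u u.2]
  · rw [← hνP u u.2]
    exact (hm.node u).symm

end Equality

end TreeUMOT

end

/-! ### The main theorem -/

theorem mainTheorem7 {N : ℕ} {X : Fin N → Type*}
    [∀ i, TopologicalSpace (X i)] [∀ i, CompactSpace (X i)] [∀ i, PolishSpace (X i)]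
    [∀ i, MeasurableSpace (X i)] [∀ i, BorelSpace (X i)]
    (lam : ∀ i, Measure (X i)) [∀ i, IsFiniteMeasure (lam i)]
    (κ : ℝ) (ε : ℝ) (hε : 0 < ε)
    (G : SimpleGraph (Fin N)) [DecidableRel G.Adj] (hG : G.IsTree)
    (t : Sym2 (Fin N) → ℝ) (ht : ∀ e ∈ G.edgeFinset, 0 < t e) (ht_sum : ∑ e ∈ G.edgeFinset, t e = 1)
    (c : ∀ j k, C(X j × X k, ℝ))
    (V : Finset (Fin N)) (hV : ∀ v ∈ V, G.degree v = 1)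
    (φ : {i // i ∈ V} → ℝ → ℝ≥0∞) (hφ : ∀ v, TreeUMOT.IsEntropyFunction (φ v))
    (μ : ∀ v : {i // i ∈ V}, FiniteMeasure (X v))
    (ν₀ : ∀ u : {i // i ∉ V}, FiniteMeasure (X u)) :
    -- equality of the two values (the measures `ν₀` enter the right-hand side only formally)
    (⨅ ν : ∀ u : {i // i ∉ V}, FiniteMeasure (X u),
        TreeUMOT.innerObjective G κ lam ε t (fun j k => c j k) V φ μ ν)
      = TreeUMOT.UMOT κ lam ε (TreeUMOT.treeCost G t (fun j k => c j k))
          (TreeUMOT.freeOff G t V φ) (TreeUMOT.joinMeasures V μ ν₀)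
    ∧
    -- the optimal plan, and the optimal measures as its marginals
    (TreeUMOT.UMOT κ lam ε (TreeUMOT.treeCost G t (fun j k => c j k))
          (TreeUMOT.freeOff G t V φ) (TreeUMOT.joinMeasures V μ ν₀) < ⊤ →
      ∃ π' : FiniteMeasure (∀ i, X i),
        (∀ π : FiniteMeasure (∀ i, X i),
          IsMinOn (TreeUMOT.umotObjective κ lam ε (TreeUMOT.treeCost G t (fun j k => c j k))
            (TreeUMOT.freeOff G t V φ) (TreeUMOT.joinMeasures V μ ν₀)) univ π ↔ π = π') ∧
        (∀ ν : ∀ u : {i // i ∉ V}, FiniteMeasure (X u),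
          IsMinOn (TreeUMOT.innerObjective G κ lam ε t (fun j k => c j k) V φ μ) univ ν ↔
            ∀ u : {i // i ∉ V},
              (ν u : Measure (X u)) = (π' : Measure (∀ i, X i)).map (fun x => x u))) := by
  have hdeg : ∀ i, ∃ j, G.Adj i j := TreeUMOT.exists_adj_of_sum_eq_one hG ht_sum
  have hlw := TreeUMOT.leafWeight_pos ht hdeg
  obtain ⟨M, hcM⟩ : ∃ M : ℝ, ∀ j k z, |c j k z| ≤ M := by
    refine ⟨∑ j, ∑ k, ‖c j k‖, fun j k z => ((c j k).norm_coe_le_norm z).trans ?_⟩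
    refine (Finset.single_le_sum (f := fun k => ‖c j k‖) (fun _ _ => norm_nonneg _)
      (Finset.mem_univ k)).trans ?_
    exact Finset.single_le_sum (f := fun j => ∑ k, ‖c j k‖)
      (fun _ _ => Finset.sum_nonneg fun _ _ => norm_nonneg _) (Finset.mem_univ j)
  have hcm : ∀ j k, Measurable (c j k) := fun j k => (c j k).continuous.measurable
  have hcost : Measurable (TreeUMOT.treeCost G t fun j k => c j k) :=
    Finset.measurable_sum _ fun e _ =>
      ((hcm _ _).comp (TreeUMOT.measurable_pair e.1 e.2)).const_mul _
  have hcostM : ∀ x, |TreeUMOT.treeCost G t (fun j k => c j k) x|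
      ≤ ∑ e ∈ TreeUMOT.orderedEdges G, t s(e.1, e.2) * M := by
    intro x
    refine (Finset.abs_sum_le_sum_abs _ _).trans (Finset.sum_le_sum fun e he => ?_)
    rw [abs_mul, abs_of_pos (TreeUMOT.edge_weight_pos ht he)]
    exact mul_le_mul_of_nonneg_left (hcM _ _ _) (TreeUMOT.edge_weight_pos ht he).le
  -- This unfolds to `umotObjective`, so its infimum is `UMOT` by definition.
  let F : FiniteMeasure (∀ i, X i) → EReal := fun π =>
    TreeUMOT.regularizedObjective κ (Measure.pi lam) ε (TreeUMOT.treeCost G t fun j k => c j k)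
      (TreeUMOT.multiPenalty G t V φ μ ν₀) π
  let J := TreeUMOT.innerObjective G κ lam ε t (fun j k => c j k) V φ μ
  have hA : ∀ ν, J ν ≠ ⊤ → ∃ Q : FiniteMeasure (∀ i, X i), F Q = J ν ∧
      ∀ u : {i // i ∉ V}, (ν u : Measure (X u)) = (Q : Measure (∀ i, X i)).map fun x => x u :=
    fun ν hν => TreeUMOT.exists_multi_of_innerObjective_ne_top hε hG ht hdeg hV hφ hcm hcM hν
  have hB : ∀ (π : FiniteMeasure (∀ i, X i)) (ν : ∀ u : {i // i ∉ V}, FiniteMeasure (X u)),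
      (∀ u : {i // i ∉ V},
        (ν u : Measure (X u)) = (π : Measure (∀ i, X i)).map fun x => x u) → J ν ≤ F π :=
    fun π ν h => TreeUMOT.innerObjective_le_of_marginals hε hG ht hdeg hV hφ hcm hcM π h
  have hEq : (⨅ ν, J ν) = ⨅ π, F π := by
    refine le_antisymm (le_iInf fun π => ?_) (le_iInf fun ν => ?_)
    · exact (iInf_le _ fun u => ⟨(π : Measure (∀ i, X i)).map fun x => x u, inferInstance⟩).trans
        (hB π _ fun u => rfl)
    · rcases eq_or_ne (J ν) ⊤ with h | h
      · rw [h]; exact le_top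
      · obtain ⟨Q, hQ, -⟩ := hA ν h
        exact (iInf_le _ Q).trans hQ.le
  refine ⟨hEq, fun hlt => ?_⟩
  change ⨅ π, F π < ⊤ at hlt
  obtain ⟨π', hval, huniq⟩ := TreeUMOT.existsUnique_regularizedObjective hε hcost hcostM
    (TreeUMOT.isConvexPenalty_multiPenalty (μ := μ) (ν := ν₀) hφ hlw) hlt
  refine ⟨π', huniq, fun ν => ⟨fun h => ?_, fun h => ?_⟩⟩
  · have hJ : J ν = ⨅ ν, J ν := le_antisymm (le_iInf fun ν' => h (mem_univ ν')) (iInf_le _ _)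
    obtain ⟨Q, hQ, hmarg⟩ := hA ν (by rw [hJ, hEq]; exact hlt.ne)
    -- The glued plan of a minimizing `ν` attains the common value, so uniqueness of the optimal
    -- plan determines the marginals `ν`.
    have hQmin : Q = π' := by
      refine (huniq Q).1 fun π _ => ?_
      change F Q ≤ F π
      rw [hQ, hJ, hEq]
      exact iInf_le _ _
    rw [← hQmin]
    exact hmarg
  · intro ν' _
    change J ν ≤ J ν'
    calc J ν ≤ F π' := hB π' ν h
      _ = ⨅ ν, J ν := (hEq.trans hval).symm
      _ ≤ J ν' := iInf_le _ _
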